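/- Let $q$ be an odd prime power, $c\in\mathbb F_q$ a non-square, $K=\mathbb F_q(t)$, and let $S\subseteq\mathbb P^1(\mathbb F_q)=\mathbb F_q\cup\{\infty\}$ be a finite set of rational places containing $\{0,\infty\}$; put $S_0=S\setminus\{0,\infty\}$. Let $\mathfrak o_S\subseteq K$ be the ring of $S$-integers (rational functions regular outside $S$), let $$\mathcal A_S=\mathfrak o_S\{Z,F\}/(Z^2=c,\ F^2=t,\ FZ=-ZF),\qquad \Lambda_S=\mathcal A_S^\times/\mathfrak o_S^\times ,$$ and write $[g]\in\Lambda_S$ for the class of $g\in\mathcal A_S^\times$. On the field $\mathbb F_q[Z]\cong\mathbb F_{q^2}$ let $\alpha\mapsto\bar\alpha$ be the conjugation $Z\mapsto -Z$ and $N(\alpha)=\alpha\bar\alpha$ the norm. For $\tau\in S_0$ and $\alpha\in\mathbb F_q[Z]$ with $N(\alpha)=\tau^{-1}$ the element $1+\alpha F$ is a unit of $\mathcal A_S$; let $$PA_\tau=\{[1+\alpha F]\ ;\ \alpha\in\mathbb F_q[Z],\ N(\alpha)=\tau^{-1}\}\subseteq\Lambda_S,\qquad \Gamma_S=\langle PA_\tau\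 ;\ \tau\in S_0\rangle\subseteq\Lambda_S .$$ For $\alpha,\beta\in\mathbb F_q[Z]^\times$ with $N(\alpha)\neq N(\beta)$ put $\zeta_\alpha(\beta)=\dfrac{1+\alpha/\beta}{1+\bar\alpha/\bar\beta}$. For $\tau\in S_0$ let $K_\tau$ be the completion of $K$ at $t=\tau$. The quaternion algebra $(c,t)$ splits over $K_\tau$, i.e. it becomes isomorphic to $M_2(K_\tau)$ as a $K_\tau$-algebra. Any choice of splittings at all $\tau\in S_0$ makes $\Lambda_S$ act on the product of trees $T_{S_0}=\prod_{\tau\in S_0}T_\tau$, where $T_\tau$ is the Bruhat–Tits tree of $\mathrm{PGL}_2(K_\tau)$: its vertices are the homothety classes of lattices in $K_\tau^2$, and two distinct vertices are adjacent if they have representatives $L,L'$ with $\mathfrak m_\tau L\subseteq L'\subseteq L$, where $\mathfrak m_\tau$ is the maximal ideal of the valuation ring of $K_\tau$. The cells of $T_{S_0}$ are the products of one vertex or edge from each $T_\tau$. **Theorem.** 1. The group $\Gamma_S$ has the following presentation: the generators are the elements of $\bigcup_{\tau\in S_0}PA_\tau$, and the defining relations are (i) $[1+\alpha F]\cdot[1-\alpha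 F]=1$ for all $\tau\in S_0$ and $[1+\alpha F]\in PA_\tau$; (ii) $[1+\alpha F]\cdot[1+\beta F]=[1+\zeta_\alpha(\beta)\beta F]\cdot[1+\zeta_\beta(\alpha)\alpha F]$ for all $\tau\neq\sigma$ in $S_0$, $[1+\alpha F]\in PA_\tau$ and $[1+\beta F]\in PA_\sigma$. 2. For every choice of splittings, $\Gamma_S$ acts on the cube complex $T_{S_0}$ (it maps cells to cells), it acts simply transitively on the vertices, and it fixes no cell: if $g\in\Gamma_S$ maps a cell onto itself (as a set), then $g=1$. Moreover, $\Gamma_S$ is torsion-free: its only element of finite order is $1$. -/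

import Mathlib

open Polynomial IsDedekindDomain
open scoped Pointwise

namespace QuatLattice

noncomputable section

/-! ### The constant quadratic extension `k[Z]`, `Z ^ 2 = c` -/

/-- The ring `k[Z]` with `Z ^ 2 = c`; it is a quadratic field extension of `k` when `c` is not a
square.  Here `star` is the conjugation `Z ↦ -Z` and `QuadraticAlgebra.norm` is the norm
`u + v Z ↦ u ^ 2 - c v ^ 2`. -/
abbrev ConstExt {k : Type*} [Field k] (c : k) : Type _ := QuadraticAlgebra k c 0

instance {k : Type*} [Field k] (c : k) [h : Fact (¬ IsSquare c)] :
    Fact (∀ r : k, r ^ 2 ≠ c + 0 * r) :=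
  ⟨fun r hr => h.out ⟨r, by rw [← sq, hr]; ring⟩⟩

/-- `ζ_α(β) = (1 + α / β) / (1 + ᾱ / β̄)`. -/
def zeta {k : Type*} [Field k] {c : k} [Fact (¬ IsSquare c)] (α β : ConstExt c) : ConstExt c :=
  (1 + α / β) / (1 + star α / star β)

lemma norm_zeta_mul {k : Type*} [Field k] {c : k} [Fact (¬ IsSquare c)] {α β : ConstExt c}
    (hβ : β.norm ≠ 0) (h : α.norm ≠ β.norm) : (zeta α β * β).norm = β.norm := by
  have hβ0 : β ≠ 0 := fun e => hβ (by rw [e, QuadraticAlgebra.norm_zero])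
  have hx : (1 + α / β) ≠ 0 := by
    intro e
    apply h
    have : α = -β := by
      field_simp at e
      linear_combination e
    rw [this, QuadraticAlgebra.norm_neg]
  have hs : (1 + star α / star β) = star (1 + α / β) := by
    have hsβ : star β ≠ 0 := by simpa using hβ0
    have h1 : star (α / β) = star α / star β := by
      rw [eq_div_iff hsβ, ← star_mul', div_mul_cancel₀ _ hβ0]
    rw [star_add, star_one, h1]
  have hsx : star (1 + α / β) ≠ 0 := star_ne_zero.2 hx
  have hz : zeta α β * star (1 + α / β) = 1 + α / β := by
    unfold zeta
    rw [hs, div_mul_cancel₀ _ hsx]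
  have hz' := congrArg QuadraticAlgebra.norm hz
  rw [map_mul, QuadraticAlgebra.norm_star] at hz'
  have hn : (1 + α / β).norm ≠ 0 := by
    rwa [Ne, QuadraticAlgebra.norm_eq_zero_iff_eq_zero]
  have : (zeta α β).norm = 1 := mul_right_cancel₀ hn (by rw [hz', one_mul])
  rw [map_mul, this, one_mul]

/-! ### The quaternion algebra `(c, t)` over `k[t]`-algebras -/

/-- The quaternion algebra `R{Z, F} / (Z ^ 2 = c, F ^ 2 = t, F Z = - Z F)` over a
`k[t]`-algebra `R`, with basis `1, Z, F, Z F`. -/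
abbrev Quat {k : Type*} [Field k] (c : k) (R : Type*) [CommRing R] [Algebra k[X] R] : Type _ :=
  QuaternionAlgebra R (algebraMap k[X] R (C c)) 0 (algebraMap k[X] R X)

/-- Extension of scalars for the quaternion algebra `(c, t)`. -/
def Quat.map {k : Type*} [Field k] (c : k) {R R' : Type*} [CommRing R] [Algebra k[X] R]
    [CommRing R'] [Algebra k[X] R'] (f : R →ₐ[k[X]] R') : Quat c R →+* Quat c R' where
  toFun x := ⟨f x.re, f x.imI, f x.imJ, f x.imK⟩
  map_one' := by ext <;> simp
  map_zero' := by ext <;> simp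
  map_mul' x y := by ext <;> simp
  map_add' x y := by ext <;> simp

/-- The inclusion `u + v Z ↦ u + v Z` of `k[Z]` into the quaternion algebra. -/
def constQuat {k : Type*} [Field k] {c : k} (R : Type*) [CommRing R] [Algebra k[X] R]
    (α : ConstExt c) : Quat c R :=
  ⟨algebraMap k[X] R (C α.re), algebraMap k[X] R (C α.im), 0, 0⟩

/-- The element `F` of the quaternion algebra. -/
def quatF {k : Type*} [Field k] (c : k) (R : Type*) [CommRing R] [Algebra k[X] R] : Quat c R :=
  ⟨0, 0, 1, 0⟩

/-- The element `1 + α F`. -/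
def onePlus {k : Type*} [Field k] {c : k} (R : Type*) [CommRing R] [Algebra k[X] R]
    (α : ConstExt c) : Quat c R :=
  1 + constQuat R α * quatF c R

lemma onePlus_mul_neg {k : Type*} [Field k] {c : k} (R : Type*) [CommRing R] [Algebra k[X] R]
    (α : ConstExt c) : onePlus R α * onePlus R (-α) =
      algebraMap R (Quat c R) (algebraMap k[X] R (1 - C α.norm * X)) := by
  have : C α.norm = C α.re * C α.re - C c * C α.im * C α.im := by
    rw [QuadraticAlgebra.norm_def]
    simp
  rw [this]
  ext <;> simp [onePlus, constQuat, quatF, QuaternionAlgebra.algebraMap_eq] <;> ring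

/-! ### The ring of `S`-integers and the group `Λ_S` -/

/-- The place `t = τ` of `k(t)`, for `τ ∈ k`. -/
def place {k : Type*} [Field k] (τ : k) : HeightOneSpectrum k[X] where
  asIdeal := Ideal.span {X - C τ}
  isPrime := (Ideal.span_singleton_prime (X_sub_C_ne_zero τ)).2 (prime_X_sub_C τ)
  ne_bot := by simpa using X_sub_C_ne_zero τ

/-- The finite places belonging to a set `S ⊆ ℙ¹(k) = k ∪ {∞}`. -/
def finPlaces {k : Type*} [Field k] (S : Finset (OnePoint k)) : Set (HeightOneSpectrum k[X]) :=
  {v | ∃ τ : k, (τ : OnePoint k) ∈ S ∧ v = place τ}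

/-- The ring of `S`-integers of `k(t)`, for a finite set `S ⊆ ℙ¹(k)` that contains `∞`: the
rational functions that are integral at all places outside `S`. -/
abbrev SInt {k : Type*} [Field k] (S : Finset (OnePoint k)) : Subalgebra k[X] (RatFunc k) :=
  (finPlaces S).integer (RatFunc k)

/-- `S₀ = S \ {0, ∞}`. -/
abbrev S0 {k : Type*} [Field k] (S : Finset (OnePoint k)) : Type _ :=
  {τ : k // τ ≠ 0 ∧ (τ : OnePoint k) ∈ S}

/-- The central subgroup of `S`-units of `k(t)` in the unit group of the quaternion order. -/
def scalars {k : Type*} [Field k] (c : k) (S : Finset (OnePoint k)) :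
    Subgroup (Quat c (SInt S))ˣ :=
  (Units.map (algebraMap (SInt S) (Quat c (SInt S))).toMonoidHom).range

instance {k : Type*} [Field k] (c : k) (S : Finset (OnePoint k)) : (scalars c S).Normal where
  conj_mem := by
    rintro _ ⟨a, rfl⟩ g
    refine ⟨a, ?_⟩
    rw [eq_mul_inv_iff_mul_eq]
    ext1
    exact Algebra.commutes _ _

/-- The `S`-arithmetic group `Λ_S`: the units of the quaternion order `(c, t)` over the `S`-integers
modulo the `S`-units. -/
abbrev Lambda {k : Type*} [Field k] (c : k) (S : Finset (OnePoint k)) : Type _ :=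
  (Quat c (SInt S))ˣ ⧸ scalars c S

lemma isUnit_onePlus {k : Type*} [Field k] {c : k} {S : Finset (OnePoint k)} (τ : S0 S)
    (α : ConstExt c) (hα : α.norm = (τ : k)⁻¹) : IsUnit (onePlus (SInt S) α) := by
  obtain ⟨τ, hτ0, hτ⟩ := τ
  replace hα : α.norm = τ⁻¹ := hα
  have key : IsUnit (algebraMap k[X] (SInt S) (1 - C α.norm * X)) := by
    have hp : (1 - C α.norm * X : k[X]) = C (-τ⁻¹) * (X - C τ) := by
      rw [hα, mul_sub, ← C_mul]
      simp [hτ0]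
      ring
    have hp0 : (1 - C α.norm * X : k[X]) ≠ 0 := by
      rw [hp]
      exact mul_ne_zero (by simpa using hτ0) (X_sub_C_ne_zero τ)
    have hv : ∀ v : HeightOneSpectrum k[X], v ∉ finPlaces S →
        v.valuation (RatFunc k) (algebraMap k[X] (RatFunc k) (1 - C α.norm * X)) = 1 := by
      intro v hv
      rw [HeightOneSpectrum.valuation_eq_one_iff_notMem]
      intro hmem
      apply hv
      refine ⟨τ, hτ, ?_⟩
      have hm : (X - C τ : k[X]) ∈ v.asIdeal := by
        have := v.asIdeal.mul_mem_left (C (-τ)) hmem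
        rw [hp, ← mul_assoc, ← C_mul] at this
        simpa [hτ0] using this
      have hmax : (place τ).asIdeal.IsMaximal := (place τ).isMaximal
      have hle : (place τ).asIdeal ≤ v.asIdeal := by
        change Ideal.span {X - C τ} ≤ _
        rwa [Ideal.span_singleton_le_iff_mem]
      exact (HeightOneSpectrum.ext (hmax.eq_of_le v.isPrime.ne_top hle)).symm
    refine IsUnit.of_mul_eq_one
      (⟨(algebraMap k[X] (RatFunc k) (1 - C α.norm * X))⁻¹, ?_⟩ : SInt S) ?_
    · intro v hv'
      rw [map_inv₀, hv v hv', inv_one]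
    · apply Subtype.ext
      change algebraMap k[X] (RatFunc k) _ * (algebraMap k[X] (RatFunc k) _)⁻¹ = 1
      apply mul_inv_cancel₀
      exact (map_ne_zero_iff _ (IsFractionRing.injective k[X] (RatFunc k))).2 hp0
  have key' := key.map (algebraMap (SInt S) (Quat c (SInt S)))
  have hcomm : onePlus (SInt S) α * onePlus (SInt S) (-α) =
      onePlus (SInt S) (-α) * onePlus (SInt S) α := by
    have h2 := onePlus_mul_neg (SInt S) (-α)
    rw [neg_neg, QuadraticAlgebra.norm_neg] at h2
    rw [h2, onePlus_mul_neg]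
  rw [← onePlus_mul_neg] at key'
  exact ((Commute.isUnit_mul_iff (show Commute _ _ from hcomm)).1 key').1

/-- The class `[1 + α F] ∈ Λ_S`, for `τ ∈ S₀` and `α ∈ k[Z]` with `N(α) = τ⁻¹`. -/
def cls {k : Type*} [Field k] {c : k} {S : Finset (OnePoint k)} (τ : S0 S)
    (α : ConstExt c) (hα : α.norm = (τ : k)⁻¹) : Lambda c S :=
  QuotientGroup.mk (isUnit_onePlus τ α hα).unit

/-- The set `PA_τ = {[1 + α F] ; N(α) = τ⁻¹}` in `Λ_S`. -/
def PA {k : Type*} [Field k] (c : k) {S : Finset (OnePoint k)} (τ : S0 S) : Set (Lambda c S) :=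
  {g | ∃ (α : ConstExt c) (hα : α.norm = (τ : k)⁻¹), g = cls τ α hα}

/-- The group `Γ_S`, generated in `Λ_S` by the sets `PA_τ`, `τ ∈ S₀`. -/
def Gamma {k : Type*} [Field k] (c : k) (S : Finset (OnePoint k)) : Subgroup (Lambda c S) :=
  Subgroup.closure (⋃ τ : S0 S, PA c τ)

/-! ### Generators and relations -/

/-- The set of generators `⋃ PA_τ`, as a type. -/
abbrev Gens {k : Type*} [Field k] (c : k) (S : Finset (OnePoint k)) : Type _ :=
  ↥(⋃ τ : S0 S, PA c τ)

/-- The generator `[1 + α F]`. -/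
def gen {k : Type*} [Field k] {c : k} {S : Finset (OnePoint k)} (τ : S0 S)
    (α : ConstExt c) (hα : α.norm = (τ : k)⁻¹) : Gens c S :=
  ⟨cls τ α hα, Set.mem_iUnion.2 ⟨τ, α, hα, rfl⟩⟩

/-- The relators of `[1 + α F] [1 - α F] = 1`. -/
def relsInv {k : Type*} [Field k] (c : k) (S : Finset (OnePoint k)) : Set (FreeGroup (Gens c S)) :=
  {r | ∃ (τ : S0 S) (α : ConstExt c) (hα : α.norm = (τ : k)⁻¹),
    r = FreeGroup.of (gen τ α hα) *
      FreeGroup.of (gen τ (-α) ((QuadraticAlgebra.norm_neg α).trans hα))}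

lemma norm_zeta_aux {k : Type*} [Field k] {c : k} [Fact (¬ IsSquare c)] {S : Finset (OnePoint k)}
    {τ σ : S0 S} (h : τ ≠ σ) {α β : ConstExt c} (hα : α.norm = (τ : k)⁻¹)
    (hβ : β.norm = (σ : k)⁻¹) : (zeta α β * β).norm = (σ : k)⁻¹ := by
  rw [norm_zeta_mul _ _, hβ]
  · rw [hβ]
    exact inv_ne_zero σ.2.1
  · rw [hα, hβ]
    exact fun e => h (Subtype.ext (inv_injective e))

/-- The relators of `[1 + α F] [1 + β F] = [1 + ζ_α(β) β F] [1 + ζ_β(α) α F]`, for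
`N(α) = τ⁻¹`, `N(β) = σ⁻¹`, `τ ≠ σ`. -/
def relsSquare {k : Type*} [Field k] (c : k) [Fact (¬ IsSquare c)] (S : Finset (OnePoint k)) :
    Set (FreeGroup (Gens c S)) :=
  {r | ∃ (τ σ : S0 S) (h : τ ≠ σ) (α β : ConstExt c) (hα : α.norm = (τ : k)⁻¹)
    (hβ : β.norm = (σ : k)⁻¹),
    r = (FreeGroup.of (gen τ α hα) * FreeGroup.of (gen σ β hβ)) *
      (FreeGroup.of (gen σ (zeta α β * β) (norm_zeta_aux h hα hβ)) *
        FreeGroup.of (gen τ (zeta β α * α) (norm_zeta_aux h.symm hβ hα)))⁻¹}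

/-! ### The Bruhat--Tits tree of `PGL₂` -/

/-- Full `O`-lattices in `K ^ 2`. -/
abbrev Lattice2 (O K : Type*) [CommRing O] [Field K] [Algebra O K] : Type _ :=
  {L : Submodule O (Fin 2 → K) // L.IsLattice K}

/-- Homothety of lattices. -/
def homothety (O K : Type*) [CommRing O] [Field K] [Algebra O K] : Setoid (Lattice2 O K) where
  r L L' := ∃ a : Kˣ, L'.1 = a • L.1
  iseqv :=
    { refl := fun L => ⟨1, (one_smul _ _).symm⟩
      symm := by
        rintro L L' ⟨a, h⟩
        exact ⟨a⁻¹, by rw [h, inv_smul_smul]⟩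
      trans := by
        rintro L L' L'' ⟨a, h⟩ ⟨b, h'⟩
        exact ⟨b * a, by rw [h', h, mul_smul]⟩ }

/-- The vertices of the Bruhat--Tits tree of `PGL₂(K)`: homothety classes of lattices in `K ^ 2`. -/
def Vertex (O K : Type*) [CommRing O] [Field K] [Algebra O K] : Type _ :=
  Quotient (homothety O K)

/-- The Bruhat--Tits tree of `PGL₂(K)`, for `K` the fraction field of a discrete valuation ring `O`
with maximal ideal `𝔪`: two distinct vertices are adjacent when they have representatives with
`𝔪 L ⊆ L' ⊆ L`. -/
def tree (O K : Type*) [CommRing O] [IsLocalRing O] [Field K] [Algebra O K] :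
    SimpleGraph (Vertex O K) :=
  SimpleGraph.fromRel fun x y => ∃ L L' : Lattice2 O K,
    Quotient.mk (homothety O K) L = x ∧ Quotient.mk (homothety O K) L' = y ∧
      IsLocalRing.maximalIdeal O • L.1 ≤ L'.1 ∧ L'.1 ≤ L.1

/-- The image `g L` of a lattice `L` under `g ∈ GL₂(K)`. -/
def Lattice2.act {O K : Type*} [CommRing O] [Field K] [Algebra O K]
    (g : (Matrix (Fin 2) (Fin 2) K)ˣ) (L : Lattice2 O K) : Lattice2 O K :=
  ⟨L.1.map ((Matrix.toLin' g.1).restrictScalars O), by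
    refine ⟨L.2.fg.map _, ?_⟩
    have h := congrArg (Submodule.map (Matrix.toLin' g.1)) L.2.span_eq_top
    rw [Submodule.map_span, Submodule.map_top] at h
    change Submodule.span K (Matrix.toLin' g.1 '' (L.1 : Set (Fin 2 → K))) = ⊤
    rw [h, LinearMap.range_eq_top]
    intro y
    refine ⟨Matrix.toLin' g⁻¹.1 y, ?_⟩
    rw [← LinearMap.comp_apply, ← Matrix.toLin'_mul, Units.mul_inv, Matrix.toLin'_one]
    rfl⟩

instance (O K : Type*) [CommRing O] [Field K] [Algebra O K] :
    MulAction (Matrix (Fin 2) (Fin 2) K)ˣ (Vertex O K) where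
  smul g := Quotient.map (Lattice2.act g) (by
    rintro L L' ⟨a, h⟩
    refine ⟨a, ?_⟩
    ext x
    simp only [Lattice2.act, h, Submodule.mem_map]
    constructor
    · rintro ⟨_, ⟨y, hy, rfl⟩, rfl⟩
      refine ⟨_, ⟨y, hy, rfl⟩, ?_⟩
      simp
    · rintro ⟨_, ⟨y, hy, rfl⟩, rfl⟩
      refine ⟨_, ⟨y, hy, rfl⟩, ?_⟩
      simp)
  one_smul x := by
    induction x using Quotient.inductionOn with
    | h L =>
      refine congrArg (Quotient.mk _) (Subtype.ext ?_)
      ext x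
      simp [Lattice2.act]
  mul_smul g h x := by
    induction x using Quotient.inductionOn with
    | h L =>
      refine congrArg (Quotient.mk _) (Subtype.ext ?_)
      ext x
      simp [Lattice2.act]

/-! ### The action of `Λ_S` on the product of trees -/

/-- The completion of `k(t)` at the place `t = τ`. -/
abbrev Kv {k : Type*} [Field k] (τ : k) : Type _ := (place τ).adicCompletion (RatFunc k)

/-- The valuation ring of the completion of `k(t)` at `t = τ`. -/
abbrev Ov {k : Type*} [Field k] (τ : k) : Type _ := (place τ).adicCompletionIntegers (RatFunc k)

/-- The inclusion of the `S`-integers into the completion at `t = τ`. -/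
def toKv {k : Type*} [Field k] (S : Finset (OnePoint k)) (τ : k) : SInt S →ₐ[k[X]] Kv τ :=
  (IsScalarTower.toAlgHom k[X] (RatFunc k) (Kv τ)).comp (SInt S).val

/-- A splitting of the quaternion algebra at the place `t = τ`. -/
abbrev Splitting {k : Type*} [Field k] (c τ : k) : Type _ :=
  Quat c (Kv τ) ≃ₐ[Kv τ] Matrix (Fin 2) (Fin 2) (Kv τ)

/-- The homomorphism from the units of the quaternion order to `GL₂(K_τ)` given by localisation and
a splitting. -/
def toGL {k : Type*} [Field k] {c : k} (S : Finset (OnePoint k)) {τ : k} (φ : Splitting c τ) :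
    (Quat c (SInt S))ˣ →* (Matrix (Fin 2) (Fin 2) (Kv τ))ˣ :=
  Units.map ((φ : Quat c (Kv τ) →+* Matrix (Fin 2) (Fin 2) (Kv τ)).comp
    (Quat.map c (toKv S τ))).toMonoidHom

/-- The action of `Λ_S` on the vertices of the Bruhat--Tits tree at `t = τ`, through localisation
and a splitting. -/
def treeAct {k : Type*} [Field k] {c : k} {S : Finset (OnePoint k)} {τ : k} (φ : Splitting c τ) :
    Lambda c S →* Equiv.Perm (Vertex (Ov τ) (Kv τ)) :=
  QuotientGroup.lift (scalars c S) ((MulAction.toPermHom _ _).comp (toGL S φ)) (by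
    rintro _ ⟨a, rfl⟩
    let b : (Kv τ)ˣ := Units.map (toKv S τ : SInt S →+* Kv τ).toMonoidHom a
    have hmat : ((toGL S φ (Units.map (algebraMap (SInt S) (Quat c (SInt S))).toMonoidHom a) :
        (Matrix (Fin 2) (Fin 2) (Kv τ))ˣ) : Matrix (Fin 2) (Fin 2) (Kv τ)) =
        algebraMap (Kv τ) _ (b : Kv τ) := by
      rw [← φ.commutes]
      change φ (Quat.map c (toKv S τ) (algebraMap (SInt S) (Quat c (SInt S)) (a : SInt S))) =
        φ (algebraMap (Kv τ) (Quat c (Kv τ)) (toKv S τ a))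
      congr 1
    ext x
    change toGL S φ _ • x = x
    induction x using Quotient.inductionOn with
    | h L =>
      refine Quotient.sound (s := homothety _ _) ⟨b⁻¹, ?_⟩
      rw [eq_inv_smul_iff]
      ext x
      have hlin : ∀ y : Fin 2 → Kv τ, Matrix.toLin' (algebraMap (Kv τ)
          (Matrix (Fin 2) (Fin 2) (Kv τ)) (b : Kv τ)) y = b • y := by
        intro y
        ext i
        simp [Matrix.algebraMap_eq_diagonal, Matrix.mulVec_diagonal, Units.smul_def]
      simp only [Lattice2.act, Submodule.mem_map, hmat, LinearMap.restrictScalars_apply, hlin]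
      exact Iff.rfl)

/-- The vertices of the product of trees `T_{S₀}`. -/
abbrev ProdVertex {k : Type*} [Field k] (S : Finset (OnePoint k)) : Type _ :=
  ∀ τ : S0 S, Vertex (Ov (τ : k)) (Kv (τ : k))

/-- The action of `Λ_S` on the vertices of the product of trees `T_{S₀}`, through localisations and
splittings at the places in `S₀`. -/
def prodAct {k : Type*} [Field k] {c : k} {S : Finset (OnePoint k)}
    (φ : ∀ τ : S0 S, Splitting c (τ : k)) (g : Lambda c S) (x : ProdVertex S) : ProdVertex S :=
  fun τ => treeAct (φ τ) g (x τ)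

/-- The vertex sets of the cells of a graph: vertices and edges. -/
def IsGraphCell {V : Type*} (G : SimpleGraph V) (s : Set V) : Prop :=
  (∃ x, s = {x}) ∨ ∃ x y, G.Adj x y ∧ s = {x, y}

/-- The cells (cubes) of the product of trees `T_{S₀}`, given by their vertex sets: products of
a vertex or an edge from each of the factors. -/
def IsCell {k : Type*} [Field k] {S : Finset (OnePoint k)} (s : Set (ProdVertex S)) : Prop :=
  ∃ e : ∀ τ : S0 S, Set (Vertex (Ov (τ : k)) (Kv (τ : k))),
    (∀ τ : S0 S, IsGraphCell (tree (Ov (τ : k)) (Kv (τ : k))) (e τ)) ∧ s = Set.univ.pi e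

end

end QuatLattice

/-! The proof plays the presented group against the action on trees.

At each `τ ∈ S₀` the quaternions over `K_τ` with integral coordinates form a maximal order: for a
suitable splitting they are exactly the integral matrices (`exists_integral_splitting`). Any other
splitting differs from this one by a conjugation, by Skolem–Noether, so every splitting has a base
vertex `v_τ` whose stabilizer consists of the scalar multiples of units of that order
(`exists_base_vertex`). The reduced norm of `1 + α F` is `1 - N(α) t`. If `N(α) = σ⁻¹` with `σ ≠ τ`,
it is a unit at `τ`, so `PA_σ` fixes `v_τ`. A reduced word in `PA_τ`, on the other hand, has a
product that does not vanish modulo `t - τ` although its norm does; such a product moves `v_τ`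
(`treeAct_prod_cls_ne`).

Let `H_τ` be the subgroup of the presented group generated by the letters of `PA_τ`. Relation (i)
yields reduced words for the elements of `H_τ`, and relation (ii) says that the `H_τ` permute
pairwise. Let `K_τ` be the stabilizer of `v_τ`; it contains every `H_σ` with `σ ≠ τ` and meets `H_τ`
trivially. Splitting off one factor `H_τ` at a time shows that an element fixing all `v_τ` is
trivial (`pres_eq_one_of_fixes`). This gives both the injectivity of the map to `Λ_S` and the
freeness of the action on vertices.

Transitivity is a division algorithm: an integral quaternion over `K_τ` of non-unit norm is
divisible by `t - τ` or, on the left, by some `1 + α F` with `N(α) = τ⁻¹`. Hence `⟨PA_τ⟩` is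
transitive on the vertices of `T_τ`, and since it fixes the other base vertices, the coordinates can
be corrected one by one.

Torsion is excluded algebraically. Elements of `Γ_S` have polynomial representatives congruent to
`1` modulo `F`, and for these a scalar power of prime exponent forces the element itself to be
scalar (`eq_algebraMap_of_pow_eq_algebraMap`). Finally, if `g` stabilizes a cell, then `g ^ 2` fixes
a vertex, so `g ^ 2 = 1` by freeness and `g = 1` by torsion-freeness. -/

namespace QuatLattice

noncomputable section

/-! ### The reduced norm -/

section Norm

variable {k : Type*} [Field k] {c : k}

/-- The reduced norm of the quaternion algebra `(c, t)`. -/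
def qnorm (c : k) (R : Type*) [CommRing R] [Algebra k[X] R] : Quat c R →* R where
  toFun x := x.re ^ 2 - algebraMap k[X] R (C c) * x.imI ^ 2
    - algebraMap k[X] R X * (x.imJ ^ 2 - algebraMap k[X] R (C c) * x.imK ^ 2)
  map_one' := by simp
  map_mul' x y := by
    simp only [QuaternionAlgebra.re_mul, QuaternionAlgebra.imI_mul, QuaternionAlgebra.imJ_mul,
      QuaternionAlgebra.imK_mul]
    ring

variable {R : Type*} [CommRing R] [Algebra k[X] R]

lemma qnorm_apply (x : Quat c R) : qnorm c R x = x.re ^ 2 - algebraMap k[X] R (C c) * x.imI ^ 2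
    - algebraMap k[X] R X * (x.imJ ^ 2 - algebraMap k[X] R (C c) * x.imK ^ 2) := rfl

lemma qnorm_map {R' : Type*} [CommRing R'] [Algebra k[X] R'] (f : R →ₐ[k[X]] R') (x : Quat c R) :
    qnorm c R' (Quat.map c f x) = f (qnorm c R x) := by
  simp [qnorm_apply, Quat.map]

lemma qnorm_smul (a : R) (x : Quat c R) : qnorm c R (a • x) = a ^ 2 * qnorm c R x := by
  simp only [qnorm_apply, QuaternionAlgebra.re_smul, QuaternionAlgebra.imI_smul,
    QuaternionAlgebra.imJ_smul, QuaternionAlgebra.imK_smul, smul_eq_mul]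
  ring

/-- The quaternion conjugate. -/
def qconj (x : Quat c R) : Quat c R := ⟨x.re, -x.imI, -x.imJ, -x.imK⟩

lemma mul_qconj (x : Quat c R) : x * qconj x = algebraMap R _ (qnorm c R x) := by
  ext <;> simp [qconj, qnorm_apply, QuaternionAlgebra.algebraMap_eq] <;> ring

lemma onePlus_eq (α : ConstExt c) : onePlus R α =
    ⟨1, 0, algebraMap k[X] R (C α.re), algebraMap k[X] R (C α.im)⟩ := by
  ext <;> simp [onePlus, constQuat, quatF]

lemma qnorm_onePlus (α : ConstExt c) :
    qnorm c R (onePlus R α) = algebraMap k[X] R (1 - C α.norm * X) := by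
  rw [onePlus_eq, qnorm_apply, QuadraticAlgebra.norm_def]
  simp
  ring

lemma map_onePlus {R' : Type*} [CommRing R'] [Algebra k[X] R'] (f : R →ₐ[k[X]] R')
    (α : ConstExt c) : Quat.map c f (onePlus R α) = onePlus R' α := by
  simp [onePlus_eq, Quat.map]

lemma algebraMap_quat (a : R) : algebraMap R (Quat c R) a = ⟨a, 0, 0, 0⟩ :=
  QuaternionAlgebra.algebraMap_eq a

/-- Since `F β = β̄ F` and `F ^ 2 = t`, the product `(1 + α F)(1 + β F)` equals `(1 + α β̄ t) + (α +
β) F`, so it is determined by `α + β` and `α β̄`. -/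
lemma onePlus_mul_onePlus_eq {α β α' β' : ConstExt c} (h₁ : α + β = β' + α')
    (h₂ : α * star β = β' * star α') :
    onePlus R α * onePlus R β = onePlus R β' * onePlus R α' := by
  have e₁ : α.re + β.re = β'.re + α'.re := congrArg QuadraticAlgebra.re h₁
  have e₂ : α.im + β.im = β'.im + α'.im := congrArg QuadraticAlgebra.im h₁
  have e₃ := congrArg QuadraticAlgebra.re h₂
  have e₄ := congrArg QuadraticAlgebra.im h₂
  simp only [QuadraticAlgebra.re_mul, QuadraticAlgebra.im_mul, QuadraticAlgebra.re_star,
    QuadraticAlgebra.im_star] at e₃ e₄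
  replace e₁ := congrArg (fun x => algebraMap k[X] R (C x)) e₁
  replace e₂ := congrArg (fun x => algebraMap k[X] R (C x)) e₂
  replace e₃ := congrArg (fun x => algebraMap k[X] R (C x)) e₃
  replace e₄ := congrArg (fun x => algebraMap k[X] R (C x)) e₄
  simp only [map_add, map_mul, map_neg, zero_mul, add_zero] at e₁ e₂ e₃ e₄
  simp only [onePlus_eq]
  ext
  · simp
    linear_combination algebraMap k[X] R X * e₃
  · simp
    linear_combination algebraMap k[X] R X * e₄
  · simp
    linear_combination e₁
  · simp
    linear_combination e₂

lemma add_ne_zero_of_norm_ne {α β : ConstExt c} (h : α.norm ≠ β.norm) : α + β ≠ 0 := by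
  intro e
  apply h
  rw [eq_neg_of_add_eq_zero_left e, QuadraticAlgebra.norm_neg]

variable [Fact (¬ IsSquare c)]

lemma zeta_mul_self {α β : ConstExt c} (hβ : β ≠ 0) (h : α.norm ≠ β.norm) :
    zeta α β * β = star β * (α + β) / (star α + star β) := by
  have hs : star α + star β ≠ 0 := by
    rw [← star_add]
    exact star_ne_zero.2 (add_ne_zero_of_norm_ne h)
  have hsβ : star β ≠ 0 := star_ne_zero.2 hβ
  have h1 : 1 + star α / star β ≠ 0 := by
    intro e
    field_simp at e
    exact hs (by rw [add_comm]; simpa using e)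
  unfold zeta
  rw [eq_div_iff hs, div_mul_eq_mul_div, div_mul_eq_mul_div, div_eq_iff h1]
  field_simp
  ring

/-- With `β' = β̄ (α + β) / (ᾱ + β̄)` and `α' = ᾱ (α + β) / (ᾱ + β̄)`, the sum `β' + α'` telescopes
to `α + β`, and in `β' * star α'` the fractions cancel to `α β̄`. -/
lemma onePlus_square {α β : ConstExt c} (hα : α ≠ 0) (hβ : β ≠ 0) (h : α.norm ≠ β.norm) :
    onePlus R α * onePlus R β = onePlus R (zeta α β * β) * onePlus R (zeta β α * α) := by
  have h0 := add_ne_zero_of_norm_ne h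
  have hs : star α + star β ≠ 0 := by
    rw [← star_add]
    exact star_ne_zero.2 h0
  have hs' : star β + star α ≠ 0 := by rwa [add_comm]
  have h0' : β + α ≠ 0 := by rwa [add_comm]
  apply onePlus_mul_onePlus_eq
  · rw [zeta_mul_self hβ h, zeta_mul_self hα h.symm, add_comm (star β) (star α), ← add_div,
      eq_div_iff hs]
    ring
  · rw [zeta_mul_self hβ h]
    have h2 : star (zeta β α * α) = α * (star β + star α) / (β + α) := by
      rw [zeta_mul_self hα h.symm, eq_div_iff h0']
      have : β + α = star (star β + star α) := by simp
      rw [this, ← star_mul', div_mul_cancel₀ _ hs', star_mul', star_star, star_add, star_add]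
      simp
    rw [h2, div_mul_div_comm, eq_div_iff (mul_ne_zero hs h0')]
    ring

end Norm

/-! ### Groups generated by permuting subgroups -/

section Permuting

variable {G : Type*} [Group G]

/-- If `A` and `B` are closed under inversion and `A B ⊆ B A`, then `⟨A⟩ ⟨B⟩ ⊆ ⟨B⟩ ⟨A⟩`. -/
lemma closure_mul_closure_subset {A B : Set G} (hA : ∀ a ∈ A, a⁻¹ ∈ A) (hB : ∀ b ∈ B, b⁻¹ ∈ B)
    (h : ∀ a ∈ A, ∀ b ∈ B, ∃ b' ∈ B, ∃ a' ∈ A, a * b = b' * a') :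
    ∀ a ∈ Subgroup.closure A, ∀ b ∈ Subgroup.closure B,
      ∃ b' ∈ Subgroup.closure B, ∃ a' ∈ Subgroup.closure A, a * b = b' * a' := by
  -- A single letter of `A` passes through a word in `B` and remains a single letter. Keeping `a' ∈
  -- A`, rather than only in the closure, is what lets the induction go on.
  have h1 : ∀ b ∈ Subgroup.closure B, ∀ a ∈ A,
      ∃ b' ∈ Subgroup.closure B, ∃ a' ∈ A, a * b = b' * a' := by
    intro b hb
    induction hb using Subgroup.closure_induction_left with
    | one => exact fun a ha => ⟨1, one_mem _, a, ha, by simp⟩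
    | mul_left x hx y hy ih =>
      intro a ha
      obtain ⟨x', hx', a', ha', e⟩ := h a ha x hx
      obtain ⟨y', hy', a'', ha'', e'⟩ := ih a' ha'
      exact ⟨x' * y', mul_mem (Subgroup.subset_closure hx') hy', a'', ha'',
        by rw [← mul_assoc, e, mul_assoc, e', mul_assoc]⟩
    | inv_mul_cancel x hx y hy ih =>
      intro a ha
      obtain ⟨x', hx', a', ha', e⟩ := h a ha x⁻¹ (hB x hx)
      obtain ⟨y', hy', a'', ha'', e'⟩ := ih a' ha'
      exact ⟨x' * y', mul_mem (Subgroup.subset_closure hx') hy', a'', ha'',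
        by rw [← mul_assoc, e, mul_assoc, e', mul_assoc]⟩
  intro a ha
  induction ha using Subgroup.closure_induction_left with
  | one => exact fun b hb => ⟨b, hb, 1, one_mem _, by simp⟩
  | mul_left x hx y hy ih =>
    intro b hb
    obtain ⟨b', hb', y', hy', e⟩ := ih b hb
    obtain ⟨b'', hb'', x', hx', e'⟩ := h1 b' hb' x hx
    exact ⟨b'', hb'', x' * y', mul_mem (Subgroup.subset_closure hx') hy',
      by rw [mul_assoc, e, ← mul_assoc, e', mul_assoc]⟩
  | inv_mul_cancel x hx y hy ih =>
    intro b hb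
    obtain ⟨b', hb', y', hy', e⟩ := ih b hb
    obtain ⟨b'', hb'', x', hx', e'⟩ := h1 b' hb' x⁻¹ (hA x hx)
    exact ⟨b'', hb'', x' * y', mul_mem (Subgroup.subset_closure hx') hy',
      by rw [mul_assoc, e, ← mul_assoc, e', mul_assoc]⟩

variable {ι : Type*} {H : ι → Subgroup G}

/-- The set of products `a * b` is stable under left multiplication by every generator: a factor
from `H i` is absorbed by `a`, and one from `H j` moves past `a` and is absorbed by `b`. -/
lemma exists_mul_of_mem_iSup_insert [DecidableEq ι]
    (hperm : ∀ i j, i ≠ j → ∀ a ∈ H i, ∀ b ∈ H j, ∃ b' ∈ H j, ∃ a' ∈ H i, a * b = b' * a')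
    (i : ι) (T : Finset ι) {g : G} (hg : g ∈ ⨆ j ∈ insert i T, H j) :
    ∃ a ∈ H i, ∃ b ∈ ⨆ j ∈ T, H j, g = a * b := by
  have key : ∀ j ∈ insert i T, ∀ x ∈ H j, ∀ a ∈ H i, ∀ b ∈ ⨆ j ∈ T, H j,
      ∃ a' ∈ H i, ∃ b' ∈ ⨆ j ∈ T, H j, x * (a * b) = a' * b' := by
    intro j hj x hx a ha b hb
    by_cases hji : j = i
    · subst hji
      exact ⟨x * a, mul_mem hx ha, b, hb, (mul_assoc _ _ _).symm⟩
    · obtain ⟨a', ha', x', hx', e⟩ := hperm j i hji x hx a ha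
      have hjT : j ∈ T := (Finset.mem_insert.1 hj).resolve_left hji
      exact ⟨a', ha', x' * b, mul_mem (le_iSup₂ (f := fun j (_ : j ∈ T) => H j) j hjT hx') hb,
        by rw [← mul_assoc, e, mul_assoc]⟩
  have hcl : (⨆ j ∈ insert i T, H j) =
      Subgroup.closure (⋃ j ∈ insert i T, (H j : Set G)) := by
    simp only [Subgroup.closure_iUnion, Subgroup.closure_eq]
  rw [hcl] at hg
  induction hg using Subgroup.closure_induction_left with
  | one => exact ⟨1, one_mem _, 1, one_mem _, by simp⟩
  | mul_left x hx y hy ih =>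
    obtain ⟨a, ha, b, hb, rfl⟩ := ih
    obtain ⟨j, hj, hxj⟩ := Set.mem_iUnion₂.1 hx
    exact key j hj x hxj a ha b hb
  | inv_mul_cancel x hx y hy ih =>
    obtain ⟨a, ha, b, hb, rfl⟩ := ih
    obtain ⟨j, hj, hxj⟩ := Set.mem_iUnion₂.1 hx
    exact key j hj x⁻¹ (inv_mem hxj) a ha b hb

/-- Suppose that `G` is generated by finitely many pairwise permuting subgroups `H i`, that `K i`
contains all `H j` with `j ≠ i` and meets `H i` trivially.  Then the intersection of the `K i` is
trivial. -/
lemma eq_one_of_mem_iInf_of_permuting [Finite ι] {K : ι → Subgroup G}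
    (hperm : ∀ i j, i ≠ j → ∀ a ∈ H i, ∀ b ∈ H j, ∃ b' ∈ H j, ∃ a' ∈ H i, a * b = b' * a')
    (htop : ⨆ i, H i = ⊤) (hHK : ∀ i j, j ≠ i → H j ≤ K i)
    (hdisj : ∀ i, ∀ g ∈ H i, g ∈ K i → g = 1) {g : G} (hg : ∀ i, g ∈ K i) : g = 1 := by
  classical
  cases nonempty_fintype ι
  have main : ∀ T : Finset ι, ∀ g ∈ ⨆ j ∈ T, H j, (∀ i, g ∈ K i) → g = 1 := by
    intro T
    induction T using Finset.induction_on with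
    | empty => simp
    | insert i T hi ih =>
      intro g hg hgK
      obtain ⟨a, ha, b, hb, rfl⟩ := exists_mul_of_mem_iSup_insert hperm i T hg
      have hbK : b ∈ K i := by
        refine (iSup₂_le fun j hj => hHK i j ?_ : (⨆ j ∈ T, H j) ≤ K i) hb
        rintro rfl
        exact hi hj
      -- `K i` contains `a * b` and `b`, hence `a`, and it meets `H i` trivially.
      have ha1 : a = 1 := hdisj i a ha (((K i).mul_mem_cancel_right hbK).1 (hgK i))
      subst ha1
      rw [one_mul] at hgK ⊢
      exact ih b hb hgK
  refine main Finset.univ g ?_ hg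
  simp [htop]

end Permuting

/-! ### The presented group -/

section Presentation

variable {k : Type*} [Field k] {c : k} {S : Finset (OnePoint k)}

lemma ne_zero_of_norm_eq_inv {τ : S0 S} {α : ConstExt c} (hα : α.norm = (τ : k)⁻¹) : α ≠ 0 := by
  rintro rfl
  rw [QuadraticAlgebra.norm_zero] at hα
  exact inv_ne_zero τ.2.1 hα.symm

lemma norm_ne_of_ne {τ σ : S0 S} (h : τ ≠ σ) {α β : ConstExt c} (hα : α.norm = (τ : k)⁻¹)
    (hβ : β.norm = (σ : k)⁻¹) : α.norm ≠ β.norm := by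
  rw [hα, hβ]
  exact fun e => h (Subtype.ext (inv_injective e))

/-- A unit of the quaternion order that is a scalar belongs to `scalars`. -/
lemma mem_scalars_of_eq_algebraMap {u : (Quat c (SInt S))ˣ} {a : SInt S}
    (h : (u : Quat c (SInt S)) = algebraMap _ _ a) : u ∈ scalars c S := by
  have h1 : a * (u⁻¹ : (Quat c (SInt S))ˣ).1.re = 1 := by
    have := congrArg QuaternionAlgebra.re (u.mul_inv)
    rw [h, ← Algebra.smul_def] at this
    simpa using this
  refine ⟨Units.mkOfMulEqOne _ _ h1, ?_⟩
  ext1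
  exact h.symm

lemma cls_mul_cls_neg (τ : S0 S) (α : ConstExt c) (hα : α.norm = (τ : k)⁻¹) :
    cls τ α hα * cls τ (-α) ((QuadraticAlgebra.norm_neg α).trans hα) = 1 := by
  unfold cls
  rw [← QuotientGroup.mk_mul, QuotientGroup.eq_one_iff]
  exact mem_scalars_of_eq_algebraMap (onePlus_mul_neg (SInt S) α)

lemma cls_neg (τ : S0 S) (α : ConstExt c) (hα : α.norm = (τ : k)⁻¹) :
    cls τ (-α) ((QuadraticAlgebra.norm_neg α).trans hα) = (cls τ α hα)⁻¹ :=
  (inv_eq_of_mul_eq_one_right (cls_mul_cls_neg τ α hα)).symm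

variable [Fact (¬ IsSquare c)]

lemma cls_square {τ σ : S0 S} (h : τ ≠ σ) {α β : ConstExt c} (hα : α.norm = (τ : k)⁻¹)
    (hβ : β.norm = (σ : k)⁻¹) : cls τ α hα * cls σ β hβ =
      cls σ (zeta α β * β) (norm_zeta_aux h hα hβ) *
        cls τ (zeta β α * α) (norm_zeta_aux h.symm hβ hα) := by
  unfold cls
  rw [← QuotientGroup.mk_mul, ← QuotientGroup.mk_mul]
  congr 1
  ext1
  exact onePlus_square (ne_zero_of_norm_eq_inv hα) (ne_zero_of_norm_eq_inv hβ)
    (norm_ne_of_ne h hα hβ)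

variable (c S) in
/-- The abstract group with generators `⋃ PA_τ` and the relations of the theorem. -/
abbrev Pres : Type _ := PresentedGroup (relsInv c S ∪ relsSquare c S)

variable (c S) in
/-- The natural homomorphism from the presented group to `Λ_S`. -/
def presToLambda : Pres c S →* Lambda c S :=
  PresentedGroup.toGroup (f := fun a : Gens c S => (a : Lambda c S)) (by
    rintro r (⟨τ, α, hα, rfl⟩ | ⟨τ, σ, h, α, β, hα, hβ, rfl⟩)
    · simpa [gen] using cls_mul_cls_neg τ α hα
    · rw [map_mul, map_mul, map_inv, map_mul, mul_inv_eq_one]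
      simpa [gen] using cls_square h hα hβ)

@[simp]
lemma presToLambda_of (a : Gens c S) : presToLambda c S (PresentedGroup.of a) = a :=
  PresentedGroup.toGroup.of _

lemma presToLambda_range : (presToLambda c S).range = Gamma c S := by
  rw [MonoidHom.range_eq_map, ← PresentedGroup.closure_range_of, MonoidHom.map_closure, Gamma]
  congr 1
  ext x
  constructor
  · rintro ⟨_, ⟨a, rfl⟩, rfl⟩
    rw [presToLambda_of]
    exact a.2
  · intro hx
    exact ⟨_, ⟨⟨x, hx⟩, rfl⟩, presToLambda_of _⟩

/-- The generator of the presented group that belongs to `1 + α F`. -/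
def presGen (τ : S0 S) (α : ConstExt c) (hα : α.norm = (τ : k)⁻¹) : Pres c S :=
  PresentedGroup.of (gen τ α hα)

lemma presToLambda_presGen (τ : S0 S) (α : ConstExt c) (hα : α.norm = (τ : k)⁻¹) :
    presToLambda c S (presGen τ α hα) = cls τ α hα :=
  presToLambda_of _

lemma presGen_neg (τ : S0 S) (α : ConstExt c) (hα : α.norm = (τ : k)⁻¹) :
    presGen τ (-α) ((QuadraticAlgebra.norm_neg α).trans hα) = (presGen τ α hα)⁻¹ := by
  refine (inv_eq_of_mul_eq_one_right ?_).symm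
  exact PresentedGroup.one_of_mem (Set.mem_union_left _ ⟨τ, α, hα, rfl⟩)

lemma presGen_square {τ σ : S0 S} (h : τ ≠ σ) {α β : ConstExt c} (hα : α.norm = (τ : k)⁻¹)
    (hβ : β.norm = (σ : k)⁻¹) : presGen τ α hα * presGen σ β hβ =
      presGen σ (zeta α β * β) (norm_zeta_aux h hα hβ) *
        presGen τ (zeta β α * α) (norm_zeta_aux h.symm hβ hα) := by
  rw [← mul_inv_eq_one]
  exact PresentedGroup.one_of_mem (Set.mem_union_right _ ⟨τ, σ, h, α, β, hα, hβ, rfl⟩)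

/-- The generators of the presented group that belong to `PA_τ`. -/
def presPA (c : k) [Fact (¬ IsSquare c)] (τ : S0 S) : Set (Pres c S) :=
  {g | ∃ (α : ConstExt c) (hα : α.norm = (τ : k)⁻¹), g = presGen τ α hα}

lemma presPA_inv {τ : S0 S} {g : Pres c S} (hg : g ∈ presPA c τ) : g⁻¹ ∈ presPA c τ := by
  obtain ⟨α, hα, rfl⟩ := hg
  exact ⟨-α, _, (presGen_neg τ α hα).symm⟩

/-- Relation (ii) is the permutation rule for single letters, and relation (i) makes the sets of
letters closed under inversion. -/
lemma presPA_permuting (τ σ : S0 S) (h : τ ≠ σ) : ∀ a ∈ Subgroup.closure (presPA c τ),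
    ∀ b ∈ Subgroup.closure (presPA c σ), ∃ b' ∈ Subgroup.closure (presPA c σ),
      ∃ a' ∈ Subgroup.closure (presPA c τ), a * b = b' * a' := by
  apply closure_mul_closure_subset (fun a => presPA_inv) (fun b => presPA_inv)
  rintro _ ⟨α, hα, rfl⟩ _ ⟨β, hβ, rfl⟩
  exact ⟨_, ⟨_, norm_zeta_aux h hα hβ, rfl⟩, _, ⟨_, norm_zeta_aux h.symm hβ hα, rfl⟩,
    presGen_square h hα hβ⟩

lemma iSup_closure_presPA : ⨆ τ : S0 S, Subgroup.closure (presPA c τ) = ⊤ := by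
  rw [← Subgroup.closure_iUnion, ← top_le_iff, ← PresentedGroup.closure_range_of]
  apply Subgroup.closure_mono
  rintro _ ⟨⟨a, ha⟩, rfl⟩
  obtain ⟨τ, α, hα, rfl⟩ := Set.mem_iUnion.1 ha
  exact Set.mem_iUnion.2 ⟨τ, α, hα, rfl⟩

/-- Every element of `⟨PA_τ⟩` in the presented group is a product along a reduced word. -/
lemma exists_reduced_word (τ : S0 S) {g : Pres c S} (hg : g ∈ Subgroup.closure (presPA c τ)) :
    ∃ l : List {α : ConstExt c // α.norm = (τ : k)⁻¹},
      l.IsChain (fun α β => (α : ConstExt c) ≠ -β) ∧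
        g = (l.map fun α => presGen τ α.1 α.2).prod := by
  have key : ∀ x ∈ presPA c τ, ∀ y : Pres c S,
      (∃ l : List {α : ConstExt c // α.norm = (τ : k)⁻¹},
        l.IsChain (fun α β => (α : ConstExt c) ≠ -β) ∧
          y = (l.map fun α => presGen τ α.1 α.2).prod) →
      ∃ l : List {α : ConstExt c // α.norm = (τ : k)⁻¹},
        l.IsChain (fun α β => (α : ConstExt c) ≠ -β) ∧
          x * y = (l.map fun α => presGen τ α.1 α.2).prod := by
    rintro _ ⟨α, hα, rfl⟩ _ ⟨l, hl, rfl⟩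
    cases l with
    | nil => exact ⟨[⟨α, hα⟩], by simp, by simp⟩
    | cons β l =>
      by_cases h : α = -β
      · refine ⟨l, hl.tail, ?_⟩
        subst h
        rw [List.map_cons, List.prod_cons, presGen_neg τ β.1 β.2, inv_mul_cancel_left]
      · exact ⟨⟨α, hα⟩ :: β :: l, List.isChain_cons_cons.2 ⟨h, hl⟩, by simp⟩
  induction hg using Subgroup.closure_induction_left with
  | one => exact ⟨[], by simp, by simp⟩
  | mul_left x hx y hy ih => exact key x hx y ih
  | inv_mul_cancel x hx y hy ih => exact key _ (presPA_inv hx) y ih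

end Presentation

/-! ### The completion at `t = τ` -/

section Local

variable {k : Type*} [Field k] {τ : k}

lemma mem_place_iff {p : k[X]} : p ∈ (place τ).asIdeal ↔ p.eval τ = 0 := by
  change p ∈ Ideal.span {X - C τ} ↔ _
  rw [Ideal.mem_span_singleton, dvd_iff_isRoot, IsRoot.def]

lemma valued_algebraMap_ratFunc (f : RatFunc k) :
    Valued.v (algebraMap (RatFunc k) (Kv τ) f) = (place τ).valuation (RatFunc k) f :=
  HeightOneSpectrum.valuedAdicCompletion_eq_valuation' _ f

lemma valued_algebraMap (p : k[X]) :
    Valued.v (algebraMap k[X] (Kv τ) p) = (place τ).valuation (RatFunc k) (algebraMap _ _ p) := by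
  rw [IsScalarTower.algebraMap_apply k[X] (RatFunc k) (Kv τ), valued_algebraMap_ratFunc]

lemma valued_algebraMap_le_one (p : k[X]) : Valued.v (algebraMap k[X] (Kv τ) p) ≤ 1 := by
  rw [valued_algebraMap]
  exact HeightOneSpectrum.valuation_le_one _ _

lemma valued_algebraMap_lt_one_iff {p : k[X]} :
    Valued.v (algebraMap k[X] (Kv τ) p) < 1 ↔ p.eval τ = 0 := by
  rw [valued_algebraMap, HeightOneSpectrum.valuation_lt_one_iff_mem, mem_place_iff]

lemma valued_algebraMap_eq_one_iff {p : k[X]} :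
    Valued.v (algebraMap k[X] (Kv τ) p) = 1 ↔ p.eval τ ≠ 0 := by
  rw [Ne, ← valued_algebraMap_lt_one_iff, not_lt]
  exact ⟨fun h => h.ge, fun h => (valued_algebraMap_le_one p).antisymm h⟩

variable (τ) in
/-- The uniformizer `t - τ`. -/
def unif : Kv τ := algebraMap k[X] (Kv τ) (X - C τ)

lemma valued_unif : Valued.v (unif τ) = WithZero.exp (-1 : ℤ) := by
  rw [unif, valued_algebraMap, HeightOneSpectrum.valuation_of_algebraMap]
  exact HeightOneSpectrum.intValuation_singleton _ (X_sub_C_ne_zero τ) rfl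

lemma unif_ne_zero : unif τ ≠ 0 := by
  intro h
  have := valued_unif (τ := τ)
  rw [h, map_zero] at this
  exact WithZero.exp_ne_zero this.symm

lemma exists_eq_unif_mul {x : Kv τ} (hx : Valued.v x < 1) :
    ∃ y : Kv τ, Valued.v y ≤ 1 ∧ x = unif τ * y := by
  refine ⟨(unif τ)⁻¹ * x, ?_, (mul_inv_cancel_left₀ unif_ne_zero x).symm⟩
  rw [map_mul, map_inv₀, valued_unif, ← WithZero.exp_neg, neg_neg]
  by_cases h0 : x = 0
  · simp [h0]
  have hv : Valued.v x ≠ 0 := (Valuation.ne_zero_iff _).2 h0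
  rw [← WithZero.exp_log hv, ← WithZero.exp_zero, WithZero.exp_lt_exp] at hx
  rw [← WithZero.exp_log hv, ← WithZero.exp_add, ← WithZero.exp_zero, WithZero.exp_le_exp]
  omega

/-- Every integral element of `K_τ` is congruent to a constant. -/
lemma exists_const_sub_lt {x : Kv τ} (hx : Valued.v x ≤ 1) :
    ∃ r : k, Valued.v (x - algebraMap k[X] (Kv τ) (C r)) < 1 := by
  -- `x` is approximated first by a rational function, by density, and then by a polynomial; the
  -- constant is the value of that polynomial at `τ`.
  obtain ⟨f, hf⟩ : ∃ f : RatFunc k, Valued.v (x - algebraMap (RatFunc k) (Kv τ) f) < 1 := by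
    have hd := HeightOneSpectrum.denseRange_algebraMap (K := RatFunc k) (v := place τ)
    have ho : IsOpen {y : Kv τ | Valued.v (x - y) < 1} := by
      have h1 : IsOpen {z : Kv τ | Valued.v z < 1} := by
        simpa only [Valuation.restrict_lt_one_iff] using Valued.isOpen_ball (Kv τ) 1
      exact h1.preimage (continuous_const.sub continuous_id)
    obtain ⟨f, hf⟩ := hd.exists_mem_open ho ⟨x, by simp⟩
    exact ⟨f, hf⟩
  have hf1 : (place τ).valuation (RatFunc k) f ≤ 1 := by
    rw [← valued_algebraMap_ratFunc]
    have : algebraMap (RatFunc k) (Kv τ) f = x - (x - algebraMap (RatFunc k) (Kv τ) f) := by ring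
    rw [this]
    exact (Valuation.map_sub _ _ _).trans (max_le hx hf.le)
  obtain ⟨p, hp⟩ := HeightOneSpectrum.exists_valuation_sub_lt_of_integer (place τ) hf1 1
  refine ⟨p.eval τ, ?_⟩
  have e : x - algebraMap k[X] (Kv τ) (C (p.eval τ)) = (x - algebraMap (RatFunc k) (Kv τ) f)
      + (algebraMap k[X] (Kv τ) (p - C (p.eval τ))
        - algebraMap (RatFunc k) (Kv τ) (algebraMap k[X] _ p - f)) := by
    rw [map_sub, map_sub, ← IsScalarTower.algebraMap_apply]
    ring
  rw [e]
  refine Valuation.map_add_lt _ hf (Valuation.map_sub_lt _ ?_ ?_)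
  · rw [valued_algebraMap_lt_one_iff]
    simp
  · rw [valued_algebraMap_ratFunc]
    simpa using hp

/-- `(1 + x) ^ m - 1` is `x` times an integral element. This bounds the successive differences in
the approximation of a square root. -/
lemma valued_one_add_pow_sub_one_le {x : Kv τ} (hx : Valued.v x ≤ 1) (m : ℕ) :
    Valued.v ((1 + x) ^ m - 1) ≤ Valued.v x := by
  induction m with
  | zero => simp
  | succ m ih =>
    have e : (1 + x) ^ (m + 1) - 1 = (1 + x) * ((1 + x) ^ m - 1) + x := by ring
    have h1 : Valued.v (1 + x) ≤ 1 := Valuation.map_add_le _ (by simp) hx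
    rw [e]
    refine Valuation.map_add_le _ ?_ le_rfl
    rw [map_mul]
    exact (mul_le_mul' h1 ih).trans_eq (one_mul _)

/-- In odd characteristic, every element of `K_τ` congruent to `1` is a square. -/
lemma exists_sq_eq [Fintype k] (hq : Odd (Fintype.card k)) {s : Kv τ} (hs : Valued.v s < 1) :
    ∃ y : Kv τ, Valued.v y ≤ 1 ∧ y ^ 2 = 1 + s := by
  obtain ⟨p, hchar⟩ := CharP.exists k
  have hp : p.Prime := CharP.char_is_prime k p
  have : Fact p.Prime := ⟨hp⟩
  obtain ⟨m, hm⟩ : Odd p := by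
    obtain ⟨n, _, hn⟩ := FiniteField.card k p
    rw [hn] at hq
    exact (Nat.odd_pow_iff n.ne_zero).1 hq
  have : CharP (Kv τ) p :=
    charP_of_injective_ringHom ((algebraMap k[X] (Kv τ)).comp (C : k →+* k[X])).injective p
  have hpow : ∀ n, (1 + s) ^ p ^ n = 1 + s ^ p ^ n := fun n => by
    rw [add_pow_char_pow, one_pow]
  have hs1 : ∀ n, Valued.v (s ^ p ^ n) ≤ 1 := fun n => by
    rw [map_pow]
    exact pow_le_one₀ zero_le hs.le
  have hanti : ∀ n N, n ≤ N → Valued.v (s ^ p ^ N) ≤ Valued.v (s ^ p ^ n) := fun n N h => by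
    rw [map_pow, map_pow]
    exact pow_le_pow_right_of_le_one' hs.le (Nat.pow_le_pow_right hp.pos h)
  have htend : Filter.Tendsto (fun n => s ^ p ^ n) Filter.atTop (nhds 0) :=
    (Valued.tendsto_zero_pow_of_v_lt_one hs).comp (tendsto_pow_atTop_atTop_of_one_lt hp.one_lt)
  have h1s : Valued.v (1 + s) ≤ 1 := Valuation.map_add_le _ (by simp) hs.le
  have he : ∀ n, (p ^ (n + 1) + 1) / 2 = (p ^ n + 1) / 2 + p ^ n * m ∧
      (p ^ n + 1) / 2 + (p ^ n + 1) / 2 = p ^ n + 1 := fun n => by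
    obtain ⟨j, hj⟩ : Odd (p ^ n) := Odd.pow ⟨m, hm⟩
    have : p ^ (n + 1) = 2 * (p ^ n * m) + p ^ n := by rw [pow_succ]; nth_rw 2 [hm]; ring
    omega
  -- Explicit approximations of the root: in characteristic `p`, `y n ^ 2 = (1 + s) ^ (p ^ n + 1) =
  -- (1 + s ^ p ^ n) * (1 + s)`, which tends to `1 + s`. With `p = 2 m + 1`, the quotient of
  -- consecutive terms is `(1 + s ^ p ^ n) ^ m`, which tends to `1`.
  set y : ℕ → Kv τ := fun n => (1 + s) ^ ((p ^ n + 1) / 2) with hy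
  have hstep : ∀ n, y (n + 1) - y n = y n * ((1 + s ^ p ^ n) ^ m - 1) := fun n => by
    simp only [hy]
    rw [(he n).1, pow_add, pow_mul, hpow]
    ring
  -- By the ultrametric inequality, the sum of the consecutive differences is bounded by the bound
  -- for the first one.
  have hle : ∀ n N, n ≤ N → Valued.v (y N - y n) ≤ Valued.v (s ^ p ^ n) := fun n N h => by
    induction N, h using Nat.le_induction with
    | base => simp
    | succ N h ih =>
      have e : y (N + 1) - y n = (y (N + 1) - y N) + (y N - y n) := by ring
      rw [e]
      refine Valuation.map_add_le _ ?_ ih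
      rw [hstep, map_mul]
      refine (mul_le_mul' ?_
        ((valued_one_add_pow_sub_one_le (hs1 N) m).trans (hanti n N h))).trans_eq (one_mul _)
      simp only [hy]
      rw [map_pow]
      exact pow_le_one₀ zero_le h1s
  have hc : CauchySeq y := by
    rw [(Valued.hasBasis_uniformity (Kv τ) _).cauchySeq_iff']
    intro γ _
    obtain ⟨N, hN⟩ := ((Valued.hasBasis_nhds_zero (Kv τ) _).tendsto_right_iff.1 htend γ
      trivial).exists
    refine ⟨N, fun n hn => ?_⟩
    change Valued.v.restrict (y N - y n) < γ.1
    rw [Valuation.map_sub_swap]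
    exact ((Valuation.restrict_le_iff _).2 (hle N n hn)).trans_lt hN
  obtain ⟨z, hz⟩ := cauchySeq_tendsto_of_complete hc
  have hz2 : z ^ 2 = 1 + s := by
    refine tendsto_nhds_unique (hz.pow 2) ?_
    have e : (fun n => y n ^ 2) = fun n => (1 + s ^ p ^ n) * (1 + s) := by
      funext n
      simp only [hy]
      rw [sq, ← pow_add, (he n).2, pow_succ, hpow]
    rw [e]
    simpa using (htend.const_add 1).mul_const (1 + s)
  refine ⟨z, ?_, hz2⟩
  rw [← hz2, map_pow] at h1s
  exact (pow_le_one_iff two_ne_zero).1 h1s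

end Local

/-! ### Splittings and the base vertex -/

section Split

variable {k : Type*} [Field k] {c : k}

/-- The splitting `Z ↦ (0, c; 1, 0)`, `F ↦ (x, -cy; y, -x)` of the quaternion algebra `(c, t)` given
by a solution of `x ^ 2 - c y ^ 2 = t`. -/
def splitOfNorm {K : Type*} [Field K] [Algebra k[X] K] (x y : K)
    (hxy : x ^ 2 - algebraMap k[X] K (C c) * y ^ 2 = algebraMap k[X] K X)
    (h2 : (2 : K) ≠ 0) (hc : algebraMap k[X] K (C c) ≠ 0) (ht : algebraMap k[X] K X ≠ 0) :
    Quat c K ≃ₐ[K] Matrix (Fin 2) (Fin 2) K :=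
  AlgEquiv.ofLinearEquiv
    { toFun := fun q =>
        !![q.re + q.imJ * x + q.imK * (algebraMap k[X] K (C c) * y),
          algebraMap k[X] K (C c) * (q.imI - q.imJ * y - q.imK * x);
          q.imI + q.imJ * y + q.imK * x,
          q.re - q.imJ * x - q.imK * (algebraMap k[X] K (C c) * y)]
      invFun := fun m =>
        ⟨(m 0 0 + m 1 1) / 2, (m 1 0 + m 0 1 / algebraMap k[X] K (C c)) / 2,
          (x * ((m 0 0 - m 1 1) / 2) - algebraMap k[X] K (C c) * y *
            ((m 1 0 - m 0 1 / algebraMap k[X] K (C c)) / 2)) / algebraMap k[X] K X,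
          (x * ((m 1 0 - m 0 1 / algebraMap k[X] K (C c)) / 2) -
            y * ((m 0 0 - m 1 1) / 2)) / algebraMap k[X] K X⟩
      map_add' := fun p q => by
        ext i j
        fin_cases i <;> fin_cases j <;> simp <;> ring
      map_smul' := fun a q => by
        ext i j
        fin_cases i <;> fin_cases j <;> simp <;> ring
      left_inv := fun q => by
        ext
        · simp
          field_simp
          ring
        · simp
          field_simp
          ring
        · simp
          field_simp
          linear_combination 2 * q.imJ * hxy
        · simp
          field_simp
          linear_combination 2 * q.imK * hxy
      right_inv := fun m => by
        ext i j
        fin_cases i <;> fin_cases j <;> simp <;> field_simp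
        · linear_combination (m 0 0 - m 1 1) * hxy
        · linear_combination -(algebraMap k[X] K (C c) * m 1 0 - m 0 1) * hxy
        · linear_combination (m 1 0 * algebraMap k[X] K (C c) - m 0 1) * hxy
        · linear_combination -(m 0 0 - m 1 1) * hxy }
    (by
      ext i j
      fin_cases i <;> fin_cases j <;> simp)
    (fun p q => by
      ext i j
      fin_cases i <;> fin_cases j <;> simp [Matrix.mul_apply]
      · linear_combination -(p.imJ * q.imJ - algebraMap k[X] K (C c) * p.imK * q.imK) * hxy
      · linear_combination -(algebraMap k[X] K (C c) * (p.imK * q.imJ - p.imJ * q.imK)) * hxy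
      · linear_combination -(p.imK * q.imJ - p.imJ * q.imK) * hxy
      · linear_combination -(p.imJ * q.imJ - algebraMap k[X] K (C c) * p.imK * q.imK) * hxy)

/-! ### Quaternions with integral coordinates and an integral splitting -/

section Integral

variable {τ : k}

/-- The quaternions over `K_τ` with integral coordinates. -/
def IsIntegralQuat (x : Quat c (Kv τ)) : Prop :=
  Valued.v x.re ≤ 1 ∧ Valued.v x.imI ≤ 1 ∧ Valued.v x.imJ ≤ 1 ∧ Valued.v x.imK ≤ 1

lemma valued_add_le_one {a b : Kv τ} (ha : Valued.v a ≤ 1) (hb : Valued.v b ≤ 1) :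
    Valued.v (a + b) ≤ 1 :=
  Valuation.map_add_le _ ha hb

lemma valued_sub_le_one {a b : Kv τ} (ha : Valued.v a ≤ 1) (hb : Valued.v b ≤ 1) :
    Valued.v (a - b) ≤ 1 :=
  (Valuation.map_sub _ _ _).trans (max_le ha hb)

lemma valued_mul_le_one {a b : Kv τ} (ha : Valued.v a ≤ 1) (hb : Valued.v b ≤ 1) :
    Valued.v (a * b) ≤ 1 := by
  rw [map_mul]
  exact mul_le_one' ha hb

lemma valued_div_le_one {a b : Kv τ} (ha : Valued.v a ≤ 1) (hb : Valued.v b = 1) :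
    Valued.v (a / b) ≤ 1 := by
  rwa [map_div₀, hb, div_one]

lemma IsIntegralQuat.mul {x y : Quat c (Kv τ)} (hx : IsIntegralQuat x) (hy : IsIntegralQuat y) :
    IsIntegralQuat (x * y) := by
  obtain ⟨x0, x1, x2, x3⟩ := hx
  obtain ⟨y0, y1, y2, y3⟩ := hy
  have hc := valued_algebraMap_le_one (τ := τ) (C c)
  have ht := valued_algebraMap_le_one (τ := τ) (X : k[X])
  refine ⟨?_, ?_, ?_, ?_⟩ <;> simp <;>
    repeat' first
      | with_reducible assumption
      | with_reducible apply valued_mul_le_one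
      | with_reducible apply valued_sub_le_one
      | with_reducible apply valued_add_le_one

lemma IsIntegralQuat.qconj {x : Quat c (Kv τ)} (hx : IsIntegralQuat x) :
    IsIntegralQuat (qconj x) := by
  obtain ⟨x0, x1, x2, x3⟩ := hx
  refine ⟨?_, ?_, ?_, ?_⟩ <;> simpa [QuatLattice.qconj]

lemma IsIntegralQuat.smul {x : Quat c (Kv τ)} (hx : IsIntegralQuat x) {a : Kv τ}
    (ha : Valued.v a ≤ 1) : IsIntegralQuat (a • x) := by
  obtain ⟨x0, x1, x2, x3⟩ := hx
  exact ⟨valued_mul_le_one ha x0, valued_mul_le_one ha x1, valued_mul_le_one ha x2,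
    valued_mul_le_one ha x3⟩

lemma IsIntegralQuat.qnorm_le_one {x : Quat c (Kv τ)} (hx : IsIntegralQuat x) :
    Valued.v (qnorm c (Kv τ) x) ≤ 1 := by
  obtain ⟨x0, x1, x2, x3⟩ := hx
  have hc := valued_algebraMap_le_one (τ := τ) (C c)
  have ht := valued_algebraMap_le_one (τ := τ) (X : k[X])
  rw [qnorm_apply]
  simp only [sq]
  repeat' first
    | with_reducible assumption
      | with_reducible apply valued_mul_le_one
      | with_reducible apply valued_sub_le_one

lemma isIntegralQuat_map (x : Quat c k[X]) :
    IsIntegralQuat (Quat.map c (Algebra.ofId k[X] (Kv τ)) x) :=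
  ⟨valued_algebraMap_le_one _, valued_algebraMap_le_one _, valued_algebraMap_le_one _,
    valued_algebraMap_le_one _⟩

/-- For `τ ≠ 0` there is a splitting under which the quaternions with integral coordinates
correspond to the integral matrices. -/
lemma exists_integral_splitting [Fintype k] (hq : Odd (Fintype.card k)) (hc : c ≠ 0) (hτ : τ ≠ 0) :
    ∃ φ : Splitting c τ, ∀ x : Quat c (Kv τ),
      IsIntegralQuat x ↔ ∀ i j, Valued.v (φ x i j) ≤ 1 := by
  have hk2 : (2 : k) ≠ 0 := by
    apply Ring.two_ne_zero
    intro h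
    rw [← Nat.not_even_iff_odd] at hq
    exact hq (Nat.even_iff.2 (FiniteField.even_card_of_char_two h))
  -- Over a finite field of odd order the norm form represents every element; here the polynomials
  -- `X ^ 2 - τ` and `-c X ^ 2` take opposite values.
  obtain ⟨a, b, hab⟩ : ∃ a b : k, a ^ 2 - c * b ^ 2 = τ := by
    have h1 : (X ^ 2 - C τ : k[X]).degree = 2 := degree_X_pow_sub_C two_pos τ
    have h2 : (C (-c) * X ^ 2 : k[X]).degree = 2 := degree_C_mul_X_pow 2 (neg_ne_zero.2 hc)
    obtain ⟨a, b, hab⟩ := FiniteField.exists_root_sum_quadratic h1 h2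
      (Nat.odd_iff.1 hq)
    refine ⟨a, b, ?_⟩
    simp at hab
    linear_combination hab
  -- `s` is a square root of `1 + τ⁻¹ (t - τ) = t / τ`, so scaling a solution of `a ^ 2 - c b ^ 2 =
  -- τ` by `s` solves the norm equation for `t`.
  obtain ⟨s, hs, hs2⟩ := exists_sq_eq (τ := τ) hq
    (s := algebraMap k[X] (Kv τ) (C τ⁻¹ * (X - C τ))) (by
      rw [valued_algebraMap_lt_one_iff]
      simp)
  have hv2 : Valued.v (2 : Kv τ) = 1 := by
    rw [← map_ofNat (algebraMap k[X] (Kv τ)) 2, valued_algebraMap_eq_one_iff]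
    simpa using hk2
  have hvc : Valued.v (algebraMap k[X] (Kv τ) (C c)) = 1 := by
    rw [valued_algebraMap_eq_one_iff]
    simpa
  have hvt : Valued.v (algebraMap k[X] (Kv τ) X) = 1 := by
    rw [valued_algebraMap_eq_one_iff]
    simpa
  have hne : ∀ {x : Kv τ}, Valued.v x = 1 → x ≠ 0 := by
    rintro x hx rfl
    simp at hx
  set x : Kv τ := s * algebraMap k[X] (Kv τ) (C a) with hx
  set y : Kv τ := s * algebraMap k[X] (Kv τ) (C b) with hy
  have hvx : Valued.v x ≤ 1 := valued_mul_le_one hs (valued_algebraMap_le_one _)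
  have hvy : Valued.v y ≤ 1 := valued_mul_le_one hs (valued_algebraMap_le_one _)
  have hxy : x ^ 2 - algebraMap k[X] (Kv τ) (C c) * y ^ 2 = algebraMap k[X] (Kv τ) X := by
    have e : (1 : k[X]) + C τ⁻¹ * (X - C τ) = C τ⁻¹ * X := by
      rw [mul_sub, ← C_mul, inv_mul_cancel₀ hτ]
      simp
    have e2 : (C a ^ 2 - C c * C b ^ 2 : k[X]) = C τ := by
      rw [← hab]
      simp
    have e3 : (C τ⁻¹ * X * C τ : k[X]) = X := by
      rw [mul_right_comm, ← C_mul, inv_mul_cancel₀ hτ]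
      simp
    calc x ^ 2 - algebraMap k[X] (Kv τ) (C c) * y ^ 2
        = s ^ 2 * algebraMap k[X] (Kv τ) (C a ^ 2 - C c * C b ^ 2) := by
          rw [hx, hy]
          simp only [map_sub, map_mul, map_pow]
          ring
      _ = algebraMap k[X] (Kv τ) (C τ⁻¹ * X * C τ) := by
          rw [hs2, e2, ← map_one (algebraMap k[X] (Kv τ)), ← map_add, e, ← map_mul]
      _ = _ := by rw [e3]
  -- Integrality passes both ways because `x` and `y` are integral and the inverse map divides only
  -- by `2`, `c` and `t`, all of them units at `τ`.
  refine ⟨splitOfNorm x y hxy (hne hv2) (hne hvc) (hne hvt), fun q => ⟨?_, fun h => ?_⟩⟩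
  · rintro ⟨q0, q1, q2, q3⟩ i j
    have hvc' := hvc.le
    fin_cases i <;> fin_cases j <;> simp [splitOfNorm, -map_mul, -map_div₀] <;>
    repeat' first
      | with_reducible assumption
      | with_reducible apply valued_mul_le_one
      | with_reducible apply valued_sub_le_one
      | with_reducible apply valued_add_le_one
  · set m := splitOfNorm x y hxy (hne hv2) (hne hvc) (hne hvt) q with hm
    have hq' : q = (splitOfNorm x y hxy (hne hv2) (hne hvc) (hne hvt)).symm m := by simp [hm]
    have h00 := h 0 0
    have h01 := h 0 1
    have h10 := h 1 0
    have h11 := h 1 1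
    have hvc' := hvc.le
    rw [hq']
    refine ⟨?_, ?_, ?_, ?_⟩ <;> simp [splitOfNorm, -map_mul, -map_div₀] <;>
    repeat' first
      | with_reducible assumption
      | with_reducible apply valued_mul_le_one
      | with_reducible apply valued_sub_le_one
      | with_reducible apply valued_add_le_one
      | with_reducible apply valued_div_le_one

end Integral

end Split

/-! ### Lattices in `K_τ ^ 2` -/

section Lattices

variable {k : Type*} [Field k] {c τ : k}

variable (τ) in
/-- The standard lattice `O_τ ^ 2`. -/
def stdLattice : Lattice2 (Ov τ) (Kv τ) :=
  ⟨Submodule.span (Ov τ) (Set.range (Pi.basisFun (Kv τ) (Fin 2))),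
    ⟨Submodule.fg_span (Set.finite_range _), by
      rw [Submodule.span_span_of_tower, Module.Basis.span_eq]⟩⟩

lemma mem_stdLattice {f : Fin 2 → Kv τ} : f ∈ (stdLattice τ).1 ↔ ∀ i, Valued.v (f i) ≤ 1 := by
  change f ∈ Submodule.span _ _ ↔ _
  rw [Module.Basis.mem_span_iff_repr_mem]
  simp only [Pi.basisFun_repr]
  refine forall_congr' fun i => ?_
  constructor
  · rintro ⟨y, hy⟩
    rw [← hy]
    exact y.2
  · intro h
    exact ⟨⟨f i, h⟩, rfl⟩

lemma mem_act {g : (Matrix (Fin 2) (Fin 2) (Kv τ))ˣ} {L : Lattice2 (Ov τ) (Kv τ)}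
    {f : Fin 2 → Kv τ} : f ∈ (Lattice2.act g L).1 ↔ g⁻¹.1.mulVec f ∈ L.1 := by
  constructor
  · rintro ⟨y, hy, rfl⟩
    change g⁻¹.1.mulVec (g.1.mulVec y) ∈ L.1
    rw [Matrix.mulVec_mulVec, Units.inv_mul, Matrix.one_mulVec]
    exact hy
  · intro h
    refine ⟨_, h, ?_⟩
    change g.1.mulVec (g⁻¹.1.mulVec f) = f
    rw [Matrix.mulVec_mulVec, Units.mul_inv, Matrix.one_mulVec]

lemma act_stdLattice_le_iff {g : (Matrix (Fin 2) (Fin 2) (Kv τ))ˣ} :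
    (stdLattice τ).1 ≤ (Lattice2.act g (stdLattice τ)).1 ↔ ∀ i j, Valued.v (g⁻¹.1 i j) ≤ 1 := by
  constructor
  · intro h i j
    have hj : Pi.single j (1 : Kv τ) ∈ (stdLattice τ).1 := by
      rw [mem_stdLattice]
      intro l
      by_cases hl : l = j
      · subst hl
        simp
      · simp [hl]
    have := mem_stdLattice.1 (mem_act.1 (h hj)) i
    simpa using this
  · intro h f hf
    rw [mem_act, mem_stdLattice]
    rw [mem_stdLattice] at hf
    intro i
    rw [Matrix.mulVec, dotProduct, Fin.sum_univ_two]
    exact valued_add_le_one (valued_mul_le_one (h i 0) (hf 0)) (valued_mul_le_one (h i 1) (hf 1))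

lemma act_stdLattice_eq_iff {g : (Matrix (Fin 2) (Fin 2) (Kv τ))ˣ} :
    Lattice2.act g (stdLattice τ) = stdLattice τ ↔
      (∀ i j, Valued.v (g.1 i j) ≤ 1) ∧ ∀ i j, Valued.v (g⁻¹.1 i j) ≤ 1 := by
  have h2 : (Lattice2.act g (stdLattice τ)).1 ≤ (stdLattice τ).1 ↔
      ∀ i j, Valued.v (g.1 i j) ≤ 1 := by
    rw [← inv_inv g, ← act_stdLattice_le_iff, inv_inv]
    constructor
    · intro h f hf
      rw [mem_act, inv_inv]
      exact h ⟨f, hf, rfl⟩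
    · rintro h _ ⟨f, hf, rfl⟩
      simpa [mem_act] using h hf
  rw [← h2, ← act_stdLattice_le_iff, Subtype.ext_iff]
  exact le_antisymm_iff

/-- A lattice over the valuation ring is free of rank two, and the matrix with such a basis as
columns carries the standard lattice to it. -/
lemma exists_act_stdLattice_eq (L : Lattice2 (Ov τ) (Kv τ)) :
    ∃ g : (Matrix (Fin 2) (Fin 2) (Kv τ))ˣ, Lattice2.act g (stdLattice τ) = L := by
  have hL : L.1.IsLattice (Kv τ) := L.2
  have hr : Module.finrank (Ov τ) L.1 = 2 := by
    rw [Submodule.IsLattice.finrank_of_pi (Kv τ) L.1, Fintype.card_fin]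
  let b : Module.Basis (Fin 2) (Ov τ) L.1 := Module.finBasisOfFinrankEq _ _ hr
  let b' : Module.Basis (Fin 2) (Kv τ) (Fin 2 → Kv τ) := b.extendOfIsLattice (Kv τ)
  let e := (Pi.basisFun (Kv τ) (Fin 2)).equiv b' (Equiv.refl _)
  let g : (Matrix (Fin 2) (Fin 2) (Kv τ))ˣ :=
    ⟨LinearMap.toMatrix' e.toLinearMap, LinearMap.toMatrix' e.symm.toLinearMap,
      by rw [← LinearMap.toMatrix'_comp]; simp,
      by rw [← LinearMap.toMatrix'_comp]; simp⟩
  refine ⟨g, Subtype.ext ?_⟩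
  change Submodule.map ((Matrix.toLin' (LinearMap.toMatrix' e.toLinearMap)).restrictScalars _)
    (Submodule.span _ _) = _
  rw [Matrix.toLin'_toMatrix', Submodule.map_span, ← Set.range_comp]
  have h1 : (⇑(e.toLinearMap.restrictScalars (Ov τ)) ∘ ⇑(Pi.basisFun (Kv τ) (Fin 2)) :
      Fin 2 → Fin 2 → Kv τ) = L.1.subtype ∘ b := by
    funext i
    change e (Pi.basisFun (Kv τ) (Fin 2) i) = (b i).1
    rw [Module.Basis.equiv_apply]
    exact Module.Basis.extendOfIsLattice_apply (Kv τ) b i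
  rw [h1, Set.range_comp, ← Submodule.map_span, b.span_eq, Submodule.map_top,
    Submodule.range_subtype]

/-- The homothety class of a lattice. -/
def latticeClass (L : Lattice2 (Ov τ) (Kv τ)) : Vertex (Ov τ) (Kv τ) :=
  Quotient.mk (homothety _ _) L

lemma latticeClass_eq_iff {L L' : Lattice2 (Ov τ) (Kv τ)} :
    latticeClass L = latticeClass L' ↔ ∃ a : (Kv τ)ˣ, L'.1 = a • L.1 :=
  Quotient.eq (r := homothety (Ov τ) (Kv τ))

variable (τ) in
/-- The class of the standard lattice. -/
def stdVertex : Vertex (Ov τ) (Kv τ) := latticeClass (stdLattice τ)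

lemma smul_latticeClass (g : (Matrix (Fin 2) (Fin 2) (Kv τ))ˣ) (L : Lattice2 (Ov τ) (Kv τ)) :
    g • latticeClass L = latticeClass (Lattice2.act g L) := rfl

lemma exists_smul_stdVertex_eq (v : Vertex (Ov τ) (Kv τ)) :
    ∃ g : (Matrix (Fin 2) (Fin 2) (Kv τ))ˣ, g • stdVertex τ = v := by
  induction v using Quotient.inductionOn with
  | h L =>
    obtain ⟨g, hg⟩ := exists_act_stdLattice_eq L
    exact ⟨g, by rw [stdVertex, smul_latticeClass, hg]; rfl⟩

/-- The scalar matrix of `a`. -/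
def scalarGL (a : (Kv τ)ˣ) : (Matrix (Fin 2) (Fin 2) (Kv τ))ˣ :=
  Units.map (algebraMap (Kv τ) (Matrix (Fin 2) (Fin 2) (Kv τ))).toMonoidHom a

lemma scalarGL_mul_coe (a : (Kv τ)ˣ) (g : (Matrix (Fin 2) (Fin 2) (Kv τ))ˣ) :
    (scalarGL a * g).1 = (a : Kv τ) • g.1 :=
  (Algebra.smul_def _ _).symm

lemma act_scalarGL_mul (a : (Kv τ)ˣ) (g : (Matrix (Fin 2) (Fin 2) (Kv τ))ˣ)
    (L : Lattice2 (Ov τ) (Kv τ)) :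
    (Lattice2.act (scalarGL a * g) L).1 = a • (Lattice2.act g L).1 := by
  ext f
  constructor
  · rintro ⟨y, hy, rfl⟩
    refine ⟨_, ⟨y, hy, rfl⟩, ?_⟩
    change a • (g.1.mulVec y) = (scalarGL a * g).1.mulVec y
    rw [scalarGL_mul_coe, Matrix.smul_mulVec, Units.smul_def]
  · rintro ⟨_, ⟨y, hy, rfl⟩, rfl⟩
    refine ⟨y, hy, ?_⟩
    change (scalarGL a * g).1.mulVec y = a • (g.1.mulVec y)
    rw [scalarGL_mul_coe, Matrix.smul_mulVec, Units.smul_def]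

lemma smul_stdVertex_eq_iff {g : (Matrix (Fin 2) (Fin 2) (Kv τ))ˣ} :
    g • stdVertex τ = stdVertex τ ↔ ∃ a : (Kv τ)ˣ,
      (∀ i j, Valued.v ((scalarGL a * g).1 i j) ≤ 1) ∧
        ∀ i j, Valued.v ((scalarGL a * g)⁻¹.1 i j) ≤ 1 := by
  simp only [← act_stdLattice_eq_iff]
  rw [stdVertex, smul_latticeClass, latticeClass_eq_iff]
  refine exists_congr fun a => ?_
  rw [Subtype.ext_iff, act_scalarGL_mul]
  exact eq_comm

/-- The elements of the local quaternion algebra that become units of the maximal order after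
multiplication with a scalar. -/
def IsUnimodular (x : Quat c (Kv τ)) : Prop :=
  ∃ a : Kv τ, a ≠ 0 ∧ IsIntegralQuat (a • x) ∧ Valued.v (qnorm c (Kv τ) (a • x)) = 1

lemma isIntegralQuat_inv {u : (Quat c (Kv τ))ˣ} (hu : IsIntegralQuat u.1)
    (hn : Valued.v (qnorm c (Kv τ) u.1) = 1) : IsIntegralQuat u⁻¹.1 := by
  have hn0 : qnorm c (Kv τ) u.1 ≠ 0 := by
    intro h
    simp [h] at hn
  have e : u⁻¹.1 = (qnorm c (Kv τ) u.1)⁻¹ • qconj u.1 := by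
    rw [Units.inv_eq_of_mul_eq_one_right]
    rw [mul_smul_comm, mul_qconj, Algebra.smul_def, ← map_mul, inv_mul_cancel₀ hn0, map_one]
  rw [e]
  apply hu.qconj.smul
  rw [map_inv₀, hn, inv_one]

/-- The norms of `u` and `u⁻¹` are both integral and have product `1`. -/
lemma valued_qnorm_eq_one {u : (Quat c (Kv τ))ˣ} (hu : IsIntegralQuat u.1)
    (hu' : IsIntegralQuat u⁻¹.1) : Valued.v (qnorm c (Kv τ) u.1) = 1 := by
  refine hu.qnorm_le_one.antisymm ?_
  have h1 : Valued.v (qnorm c (Kv τ) u.1) * Valued.v (qnorm c (Kv τ) u⁻¹.1) = 1 := by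
    rw [← map_mul, ← map_mul, Units.mul_inv, map_one, map_one]
  rw [← h1]
  exact (mul_le_mul_right hu'.qnorm_le_one _).trans_eq (mul_one _)

/-- The homomorphism to `GL₂(K_τ)` given by a splitting. -/
def splitUnits (φ : Splitting c τ) :
    (Quat c (Kv τ))ˣ →* (Matrix (Fin 2) (Fin 2) (Kv τ))ˣ :=
  Units.map (φ : Quat c (Kv τ) →+* Matrix (Fin 2) (Fin 2) (Kv τ)).toMonoidHom

/-- Every splitting has a base vertex with stabilizer the scalar multiples of units of the maximal
order. -/
lemma exists_base_vertex [Fintype k] (hq : Odd (Fintype.card k)) (hc : c ≠ 0) (hτ : τ ≠ 0)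
    (φ : Splitting c τ) : ∃ v : Vertex (Ov τ) (Kv τ),
      (∀ w, ∃ u : (Quat c (Kv τ))ˣ, splitUnits φ u • v = w) ∧
      ∀ u : (Quat c (Kv τ))ˣ, splitUnits φ u • v = v ↔
        IsUnimodular u.1 := by
  obtain ⟨φ₀, hφ₀⟩ := exists_integral_splitting (c := c) hq hc hτ
  -- Skolem–Noether: two splittings differ by an inner automorphism of the matrix algebra. The base
  -- vertex for `φ` is then the translate by `T` of the standard one.
  obtain ⟨T, hT⟩ : ∃ T : (Matrix (Fin 2) (Fin 2) (Kv τ))ˣ, ∀ x,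
      φ x = T.1 * φ₀ x * T⁻¹.1 := by
    obtain ⟨e, he⟩ := AlgEquiv.eq_linearEquivConjAlgEquiv
      ((Matrix.toLinAlgEquiv'.symm.trans (φ₀.symm.trans φ)).trans Matrix.toLinAlgEquiv' :
        Module.End (Kv τ) (Fin 2 → Kv τ) ≃ₐ[Kv τ] Module.End (Kv τ) (Fin 2 → Kv τ))
    refine ⟨⟨LinearMap.toMatrix' e.toLinearMap, LinearMap.toMatrix' e.symm.toLinearMap,
      by rw [← LinearMap.toMatrix'_comp]; simp,
      by rw [← LinearMap.toMatrix'_comp]; simp⟩, fun x => ?_⟩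
    have h1 := DFunLike.congr_fun he (Matrix.toLinAlgEquiv' (φ₀ x))
    apply Matrix.toLin'.injective
    change _ = Matrix.toLin' (LinearMap.toMatrix' e.toLinearMap * φ₀ x *
      LinearMap.toMatrix' e.symm.toLinearMap)
    rw [Matrix.toLin'_mul, Matrix.toLin'_mul, Matrix.toLin'_toMatrix', Matrix.toLin'_toMatrix']
    simp only [AlgEquiv.trans_apply, AlgEquiv.symm_apply_apply] at h1
    exact h1
  have hfT : ∀ u, splitUnits φ u = T * splitUnits φ₀ u * T⁻¹ := fun u =>
    Units.ext (hT u.1)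
  refine ⟨T • stdVertex τ, fun w => ?_, fun u => ?_⟩
  · obtain ⟨g, hg⟩ := exists_smul_stdVertex_eq (T⁻¹ • w)
    refine ⟨Units.map (φ₀.symm : _ →+* Quat c (Kv τ)).toMonoidHom g, ?_⟩
    have e : splitUnits φ₀ (Units.map (φ₀.symm : _ →+* Quat c (Kv τ)).toMonoidHom g) = g :=
      Units.ext (φ₀.apply_symm_apply g.1)
    rw [hfT, e, mul_smul, mul_smul, inv_smul_smul, hg, smul_inv_smul]
  · rw [hfT, mul_smul, mul_smul, inv_smul_smul, smul_left_cancel_iff, smul_stdVertex_eq_iff]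
    have key : ∀ a : (Kv τ)ˣ, scalarGL a * splitUnits φ₀ u =
        splitUnits φ₀
          (Units.map (algebraMap (Kv τ) (Quat c (Kv τ))).toMonoidHom a * u) := fun a => by
      ext1
      change algebraMap (Kv τ) _ _ * φ₀ _ = φ₀ (algebraMap (Kv τ) _ _ * _)
      rw [map_mul, φ₀.commutes]
    have hsm : ∀ a : (Kv τ)ˣ, (Units.map (algebraMap (Kv τ) (Quat c (Kv τ))).toMonoidHom a * u).1 =
      (a : Kv τ) • u.1 := fun a => (Algebra.smul_def _ _).symm
    constructor
    · rintro ⟨a, h1, h2⟩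
      rw [key] at h1 h2
      have i1 := (hφ₀ _).2 h1
      rw [← map_inv] at h2
      have i2 := (hφ₀ _).2 h2
      have i3 := valued_qnorm_eq_one i1 i2
      rw [hsm] at i1 i3
      exact ⟨a, a.ne_zero, i1, i3⟩
    · rintro ⟨a, ha, h1, h2⟩
      refine ⟨Units.mk0 a ha, ?_⟩
      rw [key, ← map_inv]
      rw [← Units.val_mk0 ha, ← hsm] at h1 h2
      exact ⟨(hφ₀ _).1 h1, (hφ₀ _).1 (isIntegralQuat_inv h1 h2)⟩

end Lattices

/-! ### Reduction of polynomial quaternions modulo `t - τ` -/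

section Residue

variable {k : Type*} [Field k] {c : k}

/-- The value of `u` at `t = τ`, for the quaternion `u + v F`. -/
def evalFst (τ : k) (x : Quat c k[X]) : ConstExt c := ⟨x.re.eval τ, x.imI.eval τ⟩

/-- The value of `v` at `t = τ`, for the quaternion `u + v F`. -/
def evalSnd (τ : k) (x : Quat c k[X]) : ConstExt c := ⟨x.imJ.eval τ, x.imK.eval τ⟩

/-- In `(u + v F)(u' + v' F)` one has `F v' = v̄' F` and `F ^ 2 = t`, and `t` takes the value `τ`.
-/
lemma evalFst_mul (τ : k) (x y : Quat c k[X]) : evalFst τ (x * y) =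
    evalFst τ x * evalFst τ y + evalSnd τ x * star (evalSnd τ y) * algebraMap k _ τ := by
  ext <;> simp [evalFst, evalSnd] <;> ring

lemma evalSnd_mul (τ : k) (x y : Quat c k[X]) : evalSnd τ (x * y) =
    evalFst τ x * evalSnd τ y + evalSnd τ x * star (evalFst τ y) := by
  ext <;> simp [evalFst, evalSnd] <;> ring

@[simp]
lemma evalFst_onePlus (τ : k) (α : ConstExt c) : evalFst τ (onePlus k[X] α) = 1 := by
  ext <;> simp [evalFst, onePlus_eq] <;> rfl

@[simp]
lemma evalSnd_onePlus (τ : k) (α : ConstExt c) : evalSnd τ (onePlus k[X] α) = α := by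
  ext <;> simp [evalSnd, onePlus_eq]

lemma eval_qnorm (τ : k) (x : Quat c k[X]) :
    (qnorm c k[X] x).eval τ = (evalFst τ x).norm - τ * (evalSnd τ x).norm := by
  simp only [qnorm_apply, evalFst, evalSnd, QuadraticAlgebra.norm_def]
  simp
  ring

lemma mul_star_mul_algebraMap {τ : k} (hτ : τ ≠ 0) {γ : ConstExt c} (hγ : γ.norm = τ⁻¹) :
    γ * star γ * algebraMap k _ τ = 1 := by
  rw [← QuadraticAlgebra.algebraMap_norm_eq_mul_star, hγ, ← map_mul, inv_mul_cancel₀ hτ, map_one]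

/-- Along a reduced word in the `1 + α F`, `N(α) = τ⁻¹`, the product does not vanish at `t = τ`. -/
lemma evalFst_mul_prod_ne_zero [Fact (¬ IsSquare c)] {τ : k} (hτ : τ ≠ 0)
    (l : List {α : ConstExt c // α.norm = τ⁻¹}) :
    ∀ (x : Quat c k[X]) (β : {α : ConstExt c // α.norm = τ⁻¹}), evalFst τ x ≠ 0 →
      evalSnd τ x = evalFst τ x * β → (β :: l).IsChain (fun α β => (α : ConstExt c) ≠ -β) →
        evalFst τ (x * (l.map fun α => onePlus k[X] α.1).prod) ≠ 0 := by
  induction l with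
  | nil => intro x β hx _ _; simpa using hx
  | cons γ l ih =>
    intro x β hx hxβ hl
    obtain ⟨hβγ, hl⟩ := List.isChain_cons_cons.1 hl
    have hγ := mul_star_mul_algebraMap hτ γ.2
    -- Invariant: modulo `t - τ` the partial product is `u (1 + β F)` with `u ≠ 0` and `β` its last
    -- letter. Multiplying by `1 + γ F` replaces `u` by `u (1 + β γ̄ τ)` and `β` by `γ`, and this
    -- identity shows that the new factor vanishes only for a cancelling pair `β = -γ`.
    have e : (1 + β.1 * star γ.1 * algebraMap k _ τ) * γ.1 = γ.1 + β.1 := by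
      linear_combination β.1 * hγ
    have h0 : 1 + β.1 * star γ.1 * algebraMap k _ τ ≠ 0 := by
      intro h
      rw [h, zero_mul] at e
      exact hβγ (by rw [eq_neg_iff_add_eq_zero, add_comm, ← e])
    have e1 : evalFst τ (x * onePlus k[X] γ.1) =
        evalFst τ x * (1 + β.1 * star γ.1 * algebraMap k _ τ) := by
      rw [evalFst_mul, evalFst_onePlus, evalSnd_onePlus, hxβ]
      ring
    rw [List.map_cons, List.prod_cons, ← mul_assoc]
    refine ih _ γ ?_ ?_ hl
    · rw [e1]
      exact mul_ne_zero hx h0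
    · rw [e1, mul_assoc, e, evalSnd_mul, evalFst_onePlus, evalSnd_onePlus, hxβ, star_one]
      ring

/-- The base change of a polynomial quaternion to `K_τ`. -/
abbrev toLocal (τ : k) (x : Quat c k[X]) : Quat c (Kv τ) := Quat.map c (Algebra.ofId k[X] (Kv τ)) x

lemma qnorm_toLocal (τ : k) (x : Quat c k[X]) :
    qnorm c (Kv τ) (toLocal τ x) = algebraMap k[X] (Kv τ) (qnorm c k[X] x) :=
  qnorm_map _ x

/-- Some coordinate of `x` is a unit at `τ`, so integrality of `a • x` forces `a` to be integral;
then `a ^ 2` times the norm of `x` cannot be a unit. -/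
lemma not_isUnimodular {τ : k} {x : Quat c k[X]} (h1 : evalFst τ x ≠ 0)
    (h2 : (qnorm c k[X] x).eval τ = 0) : ¬ IsUnimodular (toLocal τ x) := by
  rintro ⟨a, -, hint, hn⟩
  rw [qnorm_smul, qnorm_toLocal, map_mul, map_pow] at hn
  have h3 := valued_algebraMap_lt_one_iff.2 h2
  have ha : Valued.v a ≤ 1 := by
    have key : ∀ p : k[X], p.eval τ ≠ 0 → Valued.v (a * algebraMap k[X] (Kv τ) p) ≤ 1 →
        Valued.v a ≤ 1 := by
      intro p hp h
      rwa [map_mul, valued_algebraMap_eq_one_iff.2 hp, mul_one] at h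
    by_cases h0 : x.re.eval τ = 0
    · refine key x.imI (fun h0' => h1 ?_) hint.2.1
      ext
      · exact h0
      · exact h0'
    · exact key x.re h0 hint.1
  have : Valued.v a ^ 2 * Valued.v (algebraMap k[X] (Kv τ) (qnorm c k[X] x)) < 1 :=
    (mul_le_mul_left (pow_le_one₀ zero_le ha) _).trans_lt (by rwa [one_mul])
  exact this.ne hn

end Residue

/-! ### The action of the generators on the base vertices -/

section Action

variable {k : Type*} [Field k] {c : k} {S : Finset (OnePoint k)}

variable (c S) in
/-- The localisation of units of the quaternion order at `t = τ`. -/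
def locUnits (τ : k) : (Quat c (SInt S))ˣ →* (Quat c (Kv τ))ˣ :=
  Units.map (Quat.map c (toKv S τ)).toMonoidHom

lemma treeAct_mk {τ : k} (φ : Splitting c τ) (u : (Quat c (SInt S))ˣ) (v : Vertex (Ov τ) (Kv τ)) :
    treeAct φ (QuotientGroup.mk u : Lambda c S) v = splitUnits φ (locUnits c S τ u) • v := rfl

/-- A vertex whose stabilizer consists of the scalar multiples of units of the maximal order. -/
def IsBase {τ : k} (φ : Splitting c τ) (v : Vertex (Ov τ) (Kv τ)) : Prop :=
  (∀ w, ∃ u : (Quat c (Kv τ))ˣ, splitUnits φ u • v = w) ∧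
    ∀ u : (Quat c (Kv τ))ˣ, splitUnits φ u • v = v ↔ IsUnimodular u.1

lemma locUnits_onePlus (τ : k) (σ : S0 S) (α : ConstExt c) (hα : α.norm = (σ : k)⁻¹) :
    (locUnits c S τ (isUnit_onePlus σ α hα).unit).1 = toLocal τ (onePlus k[X] α) :=
  (map_onePlus (toKv S τ) α).trans (map_onePlus _ α).symm

/-- The norm `1 - t / σ` does not vanish at `t = τ ≠ σ`. -/
lemma isUnimodular_onePlus {τ σ : S0 S} (h : τ ≠ σ) {α : ConstExt c} (hα : α.norm = (σ : k)⁻¹) :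
    IsUnimodular (toLocal (τ : k) (onePlus k[X] α)) := by
  refine ⟨1, one_ne_zero, ?_, ?_⟩
  · rw [one_smul]
    exact isIntegralQuat_map _
  · rw [one_smul, qnorm_toLocal, valued_algebraMap_eq_one_iff, eval_qnorm, evalFst_onePlus,
      evalSnd_onePlus, hα]
    simp only [map_one]
    rw [sub_ne_zero, ← div_eq_mul_inv, ne_comm, Ne, div_eq_one_iff_eq σ.2.1]
    exact fun e => h (Subtype.ext e)

lemma treeAct_cls_of_ne {τ σ : S0 S} (h : τ ≠ σ) {φ : Splitting c (τ : k)}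
    {v : Vertex (Ov (τ : k)) (Kv (τ : k))} (hv : IsBase φ v) {α : ConstExt c}
    (hα : α.norm = (σ : k)⁻¹) : treeAct φ (cls σ α hα) v = v := by
  rw [cls, treeAct_mk, hv.2, locUnits_onePlus (τ : k) σ α hα]
  exact isUnimodular_onePlus h hα

/-- The product along the word is nonzero modulo `t - τ`, while its norm is divisible by the norm `1
- t / τ` of the first letter; hence it is not unimodular. No nonempty reduced word fixes the base
vertex. -/
lemma treeAct_prod_cls_ne [Fact (¬ IsSquare c)] {τ : S0 S} {φ : Splitting c (τ : k)}
    {v : Vertex (Ov (τ : k)) (Kv (τ : k))} (hv : IsBase φ v)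
    {l : List {α : ConstExt c // α.norm = (τ : k)⁻¹}} (hl0 : l ≠ [])
    (hl : l.IsChain (fun α β => (α : ConstExt c) ≠ -β)) :
    treeAct φ (l.map fun α => cls (S := S) τ α.1 α.2).prod v ≠ v := by
  have e1 : (l.map fun α => cls (S := S) τ α.1 α.2).prod =
      QuotientGroup.mk (l.map fun α => (isUnit_onePlus (S := S) τ α.1 α.2).unit).prod := by
    rw [← QuotientGroup.mk'_apply (scalars c S), map_list_prod, List.map_map]
    rfl
  have e2 : (locUnits c S (τ : k)
      (l.map fun α => (isUnit_onePlus (S := S) τ α.1 α.2).unit).prod).1 =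
      toLocal (τ : k) (l.map fun α => onePlus k[X] α.1).prod := by
    rw [map_list_prod, ← Units.coeHom_apply, map_list_prod, toLocal, map_list_prod, List.map_map,
      List.map_map, List.map_map]
    congr 1
    refine List.map_congr_left fun α _ => ?_
    exact locUnits_onePlus (τ : k) τ α.1 α.2
  rw [e1, treeAct_mk, Ne, hv.2, e2]
  obtain ⟨β, l, rfl⟩ := List.exists_cons_of_ne_nil hl0
  apply not_isUnimodular
  · rw [List.map_cons, List.prod_cons]
    exact evalFst_mul_prod_ne_zero τ.2.1 l _ β (by simp) (by simp) hl
  · rw [List.map_cons, List.prod_cons, map_mul, eval_mul, eval_qnorm, evalFst_onePlus,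
      evalSnd_onePlus, β.2, map_one, mul_inv_cancel₀ τ.2.1, sub_self, zero_mul]

/-- An element of the presented group that fixes a system of base vertices is trivial. -/
lemma pres_eq_one_of_fixes [Finite k] [Fact (¬ IsSquare c)] {φ : ∀ τ : S0 S, Splitting c (τ : k)}
    {v : ProdVertex S} (hv : ∀ τ, IsBase (φ τ) (v τ)) {g : Pres c S}
    (hg : ∀ τ, treeAct (φ τ) (presToLambda c S g) (v τ) = v τ) : g = 1 := by
  let K : S0 S → Subgroup (Pres c S) := fun τ =>
    (MulAction.stabilizer (Equiv.Perm (Vertex (Ov (τ : k)) (Kv (τ : k)))) (v τ)).comap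
      ((treeAct (φ τ)).comp (presToLambda c S))
  have hK : ∀ τ g, g ∈ K τ ↔ treeAct (φ τ) (presToLambda c S g) (v τ) = v τ := fun τ g => Iff.rfl
  refine eq_one_of_mem_iInf_of_permuting (K := K) (H := fun τ => Subgroup.closure (presPA c τ))
    presPA_permuting iSup_closure_presPA ?_ ?_ (fun τ => (hK τ g).2 (hg τ))
  · intro τ σ h
    rw [Subgroup.closure_le]
    rintro _ ⟨α, hα, rfl⟩
    change _ ∈ K τ
    rw [hK, presToLambda_presGen]
    exact treeAct_cls_of_ne h.symm (hv τ) hα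
  · intro τ g hg hgK
    obtain ⟨l, hl, rfl⟩ := exists_reduced_word τ hg
    by_contra h
    have hl0 : l ≠ [] := by
      rintro rfl
      simp at h
    apply treeAct_prod_cls_ne (hv τ) hl0 hl
    rw [hK, map_list_prod, List.map_map] at hgK
    simpa only [Function.comp_def, presToLambda_presGen] using hgK

end Action

/-! ### Reduction of local quaternions -/

section Reduction

variable {k : Type*} [Field k] {c : k} {τ : k}

lemma IsUnimodular.smul {x : Quat c (Kv τ)} (hx : IsUnimodular x) {b : Kv τ} (hb : b ≠ 0) :
    IsUnimodular (b • x) := by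
  obtain ⟨a, ha, h1, h2⟩ := hx
  have e : (a * b⁻¹) • b • x = a • x := by rw [smul_smul, inv_mul_cancel_right₀ hb]
  exact ⟨a * b⁻¹, mul_ne_zero ha (inv_ne_zero hb), by rwa [e], by rwa [e]⟩

/-- An integral quaternion is congruent to a constant one modulo `t - τ`. -/
lemma exists_const_add_unif_smul {x : Quat c (Kv τ)} (hx : IsIntegralQuat x) :
    ∃ (p : Quat c k[X]) (y : Quat c (Kv τ)), IsIntegralQuat y ∧ x = toLocal τ p + unif τ • y := by
  have key : ∀ a : Kv τ, Valued.v a ≤ 1 → ∃ (r : k) (b : Kv τ), Valued.v b ≤ 1 ∧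
      a = algebraMap k[X] (Kv τ) (C r) + unif τ * b := by
    intro a ha
    obtain ⟨r, hr⟩ := exists_const_sub_lt ha
    obtain ⟨b, hb, e⟩ := exists_eq_unif_mul hr
    exact ⟨r, b, hb, by rw [← e]; ring⟩
  obtain ⟨h0, h1, h2, h3⟩ := hx
  obtain ⟨r0, b0, hb0, e0⟩ := key _ h0
  obtain ⟨r1, b1, hb1, e1⟩ := key _ h1
  obtain ⟨r2, b2, hb2, e2⟩ := key _ h2
  obtain ⟨r3, b3, hb3, e3⟩ := key _ h3
  exact ⟨⟨C r0, C r1, C r2, C r3⟩, ⟨b0, b1, b2, b3⟩, ⟨hb0, hb1, hb2, hb3⟩,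
    QuaternionAlgebra.ext e0 e1 e2 e3⟩

lemma toLocal_eq_unif_smul {p : Quat c k[X]} (h1 : evalFst τ p = 0) (h2 : evalSnd τ p = 0) :
    ∃ y : Quat c (Kv τ), IsIntegralQuat y ∧ toLocal τ p = unif τ • y := by
  have key : ∀ q : k[X], q.eval τ = 0 → ∃ q', q = (X - C τ) * q' := fun q hq =>
    dvd_iff_isRoot.2 hq
  obtain ⟨q0, e0⟩ := key p.re (congrArg QuadraticAlgebra.re h1)
  obtain ⟨q1, e1⟩ := key p.imI (congrArg QuadraticAlgebra.im h1)
  obtain ⟨q2, e2⟩ := key p.imJ (congrArg QuadraticAlgebra.re h2)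
  obtain ⟨q3, e3⟩ := key p.imK (congrArg QuadraticAlgebra.im h2)
  refine ⟨toLocal τ ⟨q0, q1, q2, q3⟩, isIntegralQuat_map _, ?_⟩
  apply QuaternionAlgebra.ext
  · change algebraMap k[X] (Kv τ) p.re = _
    rw [e0, map_mul]
    rfl
  · change algebraMap k[X] (Kv τ) p.imI = _
    rw [e1, map_mul]
    rfl
  · change algebraMap k[X] (Kv τ) p.imJ = _
    rw [e2, map_mul]
    rfl
  · change algebraMap k[X] (Kv τ) p.imK = _
    rw [e3, map_mul]
    rfl

/-- The norm is a quadratic polynomial with integral coefficients in the coordinates, so modulo `t -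
τ` it depends only on the residues of these. -/
lemma valued_qnorm_add_unif_smul_sub_lt (p : Quat c k[X]) {y : Quat c (Kv τ)}
    (hy : IsIntegralQuat y) :
    Valued.v (qnorm c (Kv τ) (toLocal τ p + unif τ • y) - qnorm c (Kv τ) (toLocal τ p)) < 1 := by
  obtain ⟨x0, x1, x2, x3⟩ := isIntegralQuat_map (τ := τ) p
  obtain ⟨y0, y1, y2, y3⟩ := hy
  have hc := valued_algebraMap_le_one (τ := τ) (C c)
  have ht := valued_algebraMap_le_one (τ := τ) (X : k[X])
  have hu : Valued.v (unif τ) ≤ 1 := valued_algebraMap_le_one _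
  have hu' : Valued.v (unif τ) < 1 := valued_algebraMap_lt_one_iff.2 (by simp)
  set z := toLocal τ p with hz
  have e : qnorm c (Kv τ) (z + unif τ • y) - qnorm c (Kv τ) z =
      unif τ * (y.re * (z.re + z.re + unif τ * y.re)
        - algebraMap k[X] (Kv τ) (C c) * (y.imI * (z.imI + z.imI + unif τ * y.imI))
        - algebraMap k[X] (Kv τ) X * (y.imJ * (z.imJ + z.imJ + unif τ * y.imJ)
          - algebraMap k[X] (Kv τ) (C c) * (y.imK * (z.imK + z.imK + unif τ * y.imK)))) := by
    simp only [qnorm_apply, QuaternionAlgebra.re_add, QuaternionAlgebra.imI_add,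
      QuaternionAlgebra.imJ_add, QuaternionAlgebra.imK_add, QuaternionAlgebra.re_smul,
      QuaternionAlgebra.imI_smul, QuaternionAlgebra.imJ_smul, QuaternionAlgebra.imK_smul,
      smul_eq_mul]
    ring
  rw [e, map_mul]
  refine (mul_le_mul_right ?_ _).trans_lt (by rwa [mul_one])
  repeat' first
    | with_reducible assumption
    | with_reducible apply valued_mul_le_one
    | with_reducible apply valued_sub_le_one
    | with_reducible apply valued_add_le_one

/-- An integral quaternion of non-unit norm that is not divisible by `t - τ` is divisible from the
left by some `1 + α F` with `N(α) = τ⁻¹`. -/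
lemma exists_left_divisor [Fact (¬ IsSquare c)] (hτ : τ ≠ 0) {x : Quat c (Kv τ)}
    (hx : IsIntegralQuat x) (hn : Valued.v (qnorm c (Kv τ) x) < 1) :
    ∃ y : Quat c (Kv τ), IsIntegralQuat y ∧ (x = unif τ • y ∨
      ∃ α : ConstExt c, α.norm = τ⁻¹ ∧ toLocal τ (onePlus k[X] (-α)) * x = unif τ • y) := by
  obtain ⟨p, y, hy, rfl⟩ := exists_const_add_unif_smul hx
  have hp : (evalFst τ p).norm - τ * (evalSnd τ p).norm = 0 := by
    rw [← eval_qnorm, ← valued_algebraMap_lt_one_iff, ← qnorm_toLocal]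
    have e : qnorm c (Kv τ) (toLocal τ p) = qnorm c (Kv τ) (toLocal τ p + unif τ • y) -
      (qnorm c (Kv τ) (toLocal τ p + unif τ • y) - qnorm c (Kv τ) (toLocal τ p)) := by ring
    rw [e]
    exact Valuation.map_sub_lt _ hn (valued_qnorm_add_unif_smul_sub_lt p hy)
  -- Write `u + v F` for the residue of `x`, so that `N(u) = τ N(v)`. If `u = 0` then `N(v) = 0`,
  -- hence `v = 0` by anisotropy of the norm, and `x` is divisible by `t - τ`.
  by_cases hu : evalFst τ p = 0
  · have hw : evalSnd τ p = 0 := by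
      rw [hu, QuadraticAlgebra.norm_zero, zero_sub, neg_eq_zero] at hp
      exact QuadraticAlgebra.norm_eq_zero_iff_eq_zero.1 ((mul_eq_zero.1 hp).resolve_left hτ)
    obtain ⟨z, hz, e⟩ := toLocal_eq_unif_smul hu hw
    refine ⟨z + y, ⟨valued_add_le_one hz.1 hy.1, valued_add_le_one hz.2.1 hy.2.1,
      valued_add_le_one hz.2.2.1 hy.2.2.1, valued_add_le_one hz.2.2.2 hy.2.2.2⟩, Or.inl ?_⟩
    rw [e, smul_add]
  · have hus : star (evalFst τ p) ≠ 0 := star_ne_zero.2 hu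
    have hnu : (evalFst τ p).norm ≠ 0 := by
      rwa [Ne, QuadraticAlgebra.norm_eq_zero_iff_eq_zero]
    -- In `(1 - α F)(u + v F) = (u - α v̄ t) + (v - α ū) F` the second term vanishes exactly for `α
    -- = v / ū`. Then `N(α) = N(v) / N(u) = τ⁻¹`, which makes the first term vanish at `t = τ` as
    -- well.
    obtain ⟨α, hα⟩ : ∃ α, α * star (evalFst τ p) = evalSnd τ p := ⟨_, div_mul_cancel₀ _ hus⟩
    have hαn : α.norm = τ⁻¹ := by
      have := congrArg QuadraticAlgebra.norm hα
      rw [map_mul, QuadraticAlgebra.norm_star] at this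
      apply mul_right_cancel₀ hnu
      rw [this, eq_inv_mul_iff_mul_eq₀ hτ]
      linear_combination -hp
    have h1 : evalFst τ (onePlus k[X] (-α) * p) = 0 := by
      have e := mul_star_mul_algebraMap hτ hαn
      rw [evalFst_mul, evalFst_onePlus, evalSnd_onePlus, ← hα, star_mul', star_star]
      linear_combination -evalFst τ p * e
    have h2 : evalSnd τ (onePlus k[X] (-α) * p) = 0 := by
      rw [evalSnd_mul, evalFst_onePlus, evalSnd_onePlus, ← hα]
      ring
    obtain ⟨z, hz, e⟩ := toLocal_eq_unif_smul h1 h2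
    have hy' := (isIntegralQuat_map (τ := τ) (onePlus k[X] (-α))).mul hy
    refine ⟨z + toLocal τ (onePlus k[X] (-α)) * y, ⟨valued_add_le_one hz.1 hy'.1,
      valued_add_le_one hz.2.1 hy'.2.1, valued_add_le_one hz.2.2.1 hy'.2.2.1,
      valued_add_le_one hz.2.2.2 hy'.2.2.2⟩, Or.inr ⟨α, hαn, ?_⟩⟩
    rw [mul_add, mul_smul_comm, smul_add, ← e, ← map_mul]

end Reduction

/-! ### Factorization of local quaternions and transitivity on each tree -/

section Transitivity

variable {k : Type*} [Field k] {c : k} {S : Finset (OnePoint k)}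

/-- A quaternion over `K_τ` that is a product of an element of `⟨PA_τ⟩` and a scalar multiple of a
unit of the maximal order. -/
def IsReducible (τ : S0 S) (x : Quat c (Kv (τ : k))) : Prop :=
  ∃ u : (Quat c (SInt S))ˣ, (QuotientGroup.mk u : Lambda c S) ∈ Subgroup.closure (PA c τ) ∧
    ∃ y, IsUnimodular y ∧ x = (locUnits c S (τ : k) u).1 * y

variable {τ : S0 S} {x : Quat c (Kv (τ : k))}

lemma IsReducible.smul (hx : IsReducible τ x) {b : Kv (τ : k)} (hb : b ≠ 0) :
    IsReducible τ (b • x) := by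
  obtain ⟨u, hu, y, hy, rfl⟩ := hx
  exact ⟨u, hu, b • y, hy.smul hb, (mul_smul_comm _ _ _).symm⟩

lemma IsReducible.of_smul {b : Kv (τ : k)} (hb : b ≠ 0) (hx : IsReducible τ (b • x)) :
    IsReducible τ x := by
  have := hx.smul (inv_ne_zero hb)
  rwa [inv_smul_smul₀ hb] at this

lemma IsReducible.onePlus_mul (hx : IsReducible τ x) {α : ConstExt c}
    (hα : α.norm = (τ : k)⁻¹) : IsReducible τ (toLocal (τ : k) (onePlus k[X] α) * x) := by
  obtain ⟨u, hu, y, hy, rfl⟩ := hx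
  refine ⟨(isUnit_onePlus τ α hα).unit * u, ?_, y, hy, ?_⟩
  · rw [QuotientGroup.mk_mul]
    exact mul_mem (Subgroup.subset_closure ⟨α, hα, rfl⟩) hu
  · rw [map_mul, Units.val_mul, locUnits_onePlus (τ : k) τ α hα, mul_assoc]

/-- Strong induction on the valuation `n` of the norm: taking out `t - τ` lowers `n` by two, and
dividing by some `1 + α F` lowers it by one, until the norm is a unit. -/
lemma isReducible_of_integral [Fact (¬ IsSquare c)] (n : ℕ) :
    ∀ x : Quat c (Kv (τ : k)), IsIntegralQuat x →
      Valued.v (qnorm c (Kv (τ : k)) x) = WithZero.exp (-n : ℤ) → IsReducible τ x := by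
  induction n using Nat.strong_induction_on with
  | _ n ih =>
    intro x hx hn
    rcases Nat.eq_zero_or_pos n with rfl | hpos
    · refine ⟨1, one_mem _, x, ⟨1, one_ne_zero, ?_, ?_⟩, by simp⟩
      · rwa [one_smul]
      · rw [one_smul, hn]
        simp
    have hlt : Valued.v (qnorm c (Kv (τ : k)) x) < 1 := by
      rw [hn, ← WithZero.exp_zero, WithZero.exp_lt_exp]
      omega
    obtain ⟨y, hy, rfl | ⟨α, hα, e⟩⟩ := exists_left_divisor τ.2.1 hx hlt
    · refine IsReducible.smul ?_ unif_ne_zero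
      rw [qnorm_smul, map_mul, map_pow, valued_unif, ← WithZero.exp_nsmul] at hn
      have hn' : Valued.v (qnorm c (Kv (τ : k)) y) = WithZero.exp (2 - n : ℤ) := by
        have h := congrArg (WithZero.exp (2 : ℤ) * ·) hn
        simp only [← mul_assoc, ← WithZero.exp_add] at h
        simpa [sub_eq_add_neg] using h
      have h2 : 2 ≤ n := by
        have h := hy.qnorm_le_one
        rw [hn', ← WithZero.exp_zero, WithZero.exp_le_exp] at h
        omega
      refine ih (n - 2) (by omega) y hy ?_
      rw [hn']
      congr 1
      omega
    · have hs : (1 - C α.norm * X : k[X]) = C (-(τ : k)⁻¹) * (X - C (τ : k)) := by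
        rw [hα, mul_sub, ← C_mul]
        simp [τ.2.1]
        ring
      have hv : Valued.v (algebraMap k[X] (Kv (τ : k)) (1 - C α.norm * X)) =
          WithZero.exp (-1 : ℤ) := by
        have h1 : Valued.v (algebraMap k[X] (Kv (τ : k)) (C (-(τ : k)⁻¹))) = 1 := by
          rw [valued_algebraMap_eq_one_iff]
          simpa using τ.2.1
        rw [hs, map_mul, map_mul, h1, one_mul]
        exact valued_unif
      have hs0 : algebraMap k[X] (Kv (τ : k)) (1 - C α.norm * X) ≠ 0 := by
        intro h
        rw [h, map_zero] at hv
        exact WithZero.exp_ne_zero hv.symm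
      -- Comparing the norms in `(1 - α F) x = (t - τ) y` gives valuations `1 + n` on the left and
      -- `2 + v(N(y))` on the right.
      have hy' : Valued.v (qnorm c (Kv (τ : k)) y) = WithZero.exp (-(n - 1 : ℕ) : ℤ) := by
        have h := congrArg (fun z => Valued.v (qnorm c (Kv (τ : k)) z)) e
        simp only [map_mul, qnorm_smul, qnorm_toLocal, qnorm_onePlus, Algebra.algebraMap_self,
          RingHom.id_apply, QuadraticAlgebra.norm_neg, map_pow, hn, hv, valued_unif] at h
        rw [← WithZero.exp_nsmul, ← WithZero.exp_add] at h
        have h' := congrArg (WithZero.exp (2 : ℤ) * ·) h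
        simp only [← mul_assoc, ← WithZero.exp_add] at h'
        rw [show (2 : ℤ) + 2 • (-1) = 0 by norm_num, WithZero.exp_zero, one_mul] at h'
        rw [← h']
        congr 1
        omega
      -- Multiplying back by `1 + α F` returns `x` up to the nonzero scalar `1 - N(α) t`, which
      -- reducibility ignores.
      have hy2 := ((ih (n - 1) (by omega) y hy hy').smul unif_ne_zero).onePlus_mul hα
      rw [← e, ← mul_assoc, toLocal, toLocal, ← map_mul, onePlus_mul_neg] at hy2
      refine IsReducible.of_smul hs0 ?_
      rw [Algebra.smul_def]
      convert hy2 using 2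
      ext <;> simp [Quat.map, algebraMap_quat]

/-- A large power of `t - τ` clears the denominators, and reducibility is insensitive to scalars. -/
lemma isReducible_unit [Fact (¬ IsSquare c)] (u : (Quat c (Kv (τ : k)))ˣ) : IsReducible τ u.1 := by
  have key : ∀ a : Kv (τ : k), ∃ n : ℕ, ∀ m, n ≤ m → Valued.v (unif (τ : k) ^ m * a) ≤ 1 := by
    intro a
    by_cases ha : a = 0
    · exact ⟨0, fun m _ => by simp [ha]⟩
    have hv : Valued.v a ≠ 0 := (Valuation.ne_zero_iff _).2 ha
    refine ⟨(WithZero.log (Valued.v a)).toNat, fun m hm => ?_⟩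
    rw [map_mul, map_pow, valued_unif, ← WithZero.exp_log hv, ← WithZero.exp_nsmul,
      ← WithZero.exp_add, ← WithZero.exp_zero, WithZero.exp_le_exp]
    simp
    omega
  obtain ⟨n0, h0⟩ := key u.1.re
  obtain ⟨n1, h1⟩ := key u.1.imI
  obtain ⟨n2, h2⟩ := key u.1.imJ
  obtain ⟨n3, h3⟩ := key u.1.imK
  set m := n0 + n1 + n2 + n3
  have hm : unif (τ : k) ^ m ≠ 0 := pow_ne_zero _ unif_ne_zero
  have hint : IsIntegralQuat (unif (τ : k) ^ m • u.1) :=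
    ⟨h0 m (by omega), h1 m (by omega), h2 m (by omega), h3 m (by omega)⟩
  have hu0 : qnorm c (Kv (τ : k)) u.1 ≠ 0 := (u.isUnit.map (qnorm c (Kv (τ : k)))).ne_zero
  have hne : Valued.v (qnorm c (Kv (τ : k)) (unif (τ : k) ^ m • u.1)) ≠ 0 := by
    rw [Valuation.ne_zero_iff, qnorm_smul]
    exact mul_ne_zero (pow_ne_zero _ hm) hu0
  have hle := hint.qnorm_le_one
  rw [← WithZero.exp_log hne, ← WithZero.exp_zero, WithZero.exp_le_exp] at hle
  refine IsReducible.of_smul hm (isReducible_of_integral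
    (-WithZero.log (Valued.v (qnorm c (Kv (τ : k)) (unif (τ : k) ^ m • u.1)))).toNat _ hint ?_)
  rw [Int.toNat_of_nonneg (by omega), neg_neg, WithZero.exp_log hne]

end Transitivity

/-! ### Simple transitivity -/

section SimplyTransitive

variable {k : Type*} [Field k] {c : k} {S : Finset (OnePoint k)}

lemma treeAct_eq_of_mem_closure_of_ne {τ σ : S0 S} (h : τ ≠ σ) {φ : Splitting c (τ : k)}
    {v : Vertex (Ov (τ : k)) (Kv (τ : k))} (hv : IsBase φ v) {g : Lambda c S}
    (hg : g ∈ Subgroup.closure (PA c σ)) : treeAct φ g v = v := by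
  let K : Subgroup (Lambda c S) :=
    (MulAction.stabilizer (Equiv.Perm (Vertex (Ov (τ : k)) (Kv (τ : k)))) v).comap (treeAct φ)
  have hle : Subgroup.closure (PA c σ) ≤ K := by
    rw [Subgroup.closure_le]
    rintro _ ⟨α, hα, rfl⟩
    exact treeAct_cls_of_ne h hv hα
  exact hle hg

lemma closure_PA_le_Gamma (τ : S0 S) : Subgroup.closure (PA c τ) ≤ Gamma c S :=
  Subgroup.closure_mono (Set.subset_iUnion _ τ)

lemma treeAct_inv_apply_eq_iff {τ : k} {φ : Splitting c τ} {g : Lambda c S}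
    {v w : Vertex (Ov τ) (Kv τ)} : treeAct φ g⁻¹ v = w ↔ treeAct φ g w = v := by
  rw [map_inv, Equiv.Perm.inv_eq_iff_eq, eq_comm]

lemma prodAct_mul {φ : ∀ τ : S0 S, Splitting c (τ : k)} (g h : Lambda c S) (x : ProdVertex S) :
    prodAct φ (g * h) x = prodAct φ g (prodAct φ h x) := by
  funext τ
  simp [prodAct]

lemma prodAct_inv_eq_iff {φ : ∀ τ : S0 S, Splitting c (τ : k)} {g : Lambda c S}
    {x y : ProdVertex S} : prodAct φ g⁻¹ x = y ↔ prodAct φ g y = x := by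
  simp only [funext_iff, prodAct, treeAct_inv_apply_eq_iff]

variable [Fact (¬ IsSquare c)]

/-- If `w = u • v` and `u = u₀ y` with `y` unimodular, then `y` fixes `v`, so `u₀` already carries
`v` to `w`. -/
lemma exists_mem_closure_treeAct_eq {τ : S0 S} {φ : Splitting c (τ : k)}
    {v : Vertex (Ov (τ : k)) (Kv (τ : k))} (hv : IsBase φ v)
    (w : Vertex (Ov (τ : k)) (Kv (τ : k))) :
    ∃ g ∈ Subgroup.closure (PA c τ), treeAct φ (g : Lambda c S) v = w := by
  obtain ⟨u, rfl⟩ := hv.1 w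
  obtain ⟨u₀, hu₀, y, hy, e⟩ := isReducible_unit (S := S) u
  refine ⟨_, hu₀, ?_⟩
  have hy' : y = ((locUnits c S (τ : k) u₀)⁻¹ * u).1 := by
    rw [Units.val_mul, e, Units.inv_mul_cancel_left]
  rw [hy', ← hv.2, map_mul, map_inv, mul_smul, inv_smul_eq_iff] at hy
  rw [treeAct_mk, hy]

lemma exists_mem_Gamma_prodAct_base_eq [Finite k] {φ : ∀ τ : S0 S, Splitting c (τ : k)}
    {v : ProdVertex S} (hv : ∀ τ, IsBase (φ τ) (v τ)) (y : ProdVertex S) :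
    ∃ g ∈ Gamma c S, prodAct φ g v = y := by
  classical
  cases nonempty_fintype (S0 S)
  -- Coordinates are brought to the base vertex one at a time. Working with `g⁻¹` applied to `y`
  -- matters: the correction from `⟨PA_σ⟩` then acts on coordinates already equal to base vertices,
  -- which it fixes.
  have key : ∀ T : Finset (S0 S), ∃ g ∈ Gamma c S, ∀ τ ∈ T, treeAct (φ τ) g⁻¹ (y τ) = v τ := by
    intro T
    induction T using Finset.induction_on with
    | empty => exact ⟨1, one_mem _, by simp⟩
    | insert σ T hσ ih =>
      obtain ⟨g, hg, hgT⟩ := ih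
      obtain ⟨γ, hγ, e⟩ := exists_mem_closure_treeAct_eq (hv σ) (treeAct (φ σ) g⁻¹ (y σ))
      refine ⟨g * γ, mul_mem hg (closure_PA_le_Gamma σ hγ), fun τ hτ => ?_⟩
      rw [mul_inv_rev, map_mul, Equiv.Perm.mul_apply, treeAct_inv_apply_eq_iff]
      rcases Finset.mem_insert.1 hτ with rfl | hτT
      · exact e
      · rw [hgT τ hτT]
        exact treeAct_eq_of_mem_closure_of_ne (fun h : τ = σ => hσ (h ▸ hτT)) (hv τ) hγ
  obtain ⟨g, hg, h⟩ := key Finset.univ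
  exact ⟨g, hg, funext fun τ => treeAct_inv_apply_eq_iff.1 (h τ (Finset.mem_univ τ))⟩

lemma eq_one_of_mem_Gamma_of_fixes_base [Finite k] {φ : ∀ τ : S0 S, Splitting c (τ : k)}
    {v : ProdVertex S} (hv : ∀ τ, IsBase (φ τ) (v τ)) {g : Lambda c S} (hg : g ∈ Gamma c S)
    (h : prodAct φ g v = v) : g = 1 := by
  rw [← presToLambda_range] at hg
  obtain ⟨p, rfl⟩ := hg
  rw [pres_eq_one_of_fixes hv (g := p) (fun τ => congrFun h τ), map_one]

lemma existsUnique_prodAct_eq [Finite k] {φ : ∀ τ : S0 S, Splitting c (τ : k)}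
    {v : ProdVertex S} (hv : ∀ τ, IsBase (φ τ) (v τ)) (x y : ProdVertex S) :
    ∃! g : Lambda c S, g ∈ Gamma c S ∧ prodAct φ g x = y := by
  obtain ⟨a, ha, hax⟩ := exists_mem_Gamma_prodAct_base_eq hv x
  obtain ⟨b, hb, hby⟩ := exists_mem_Gamma_prodAct_base_eq hv y
  refine ⟨b * a⁻¹, ⟨mul_mem hb (inv_mem ha), ?_⟩, ?_⟩
  · rw [prodAct_mul, prodAct_inv_eq_iff.2 hax, hby]
  · rintro g ⟨hg, hgx⟩
    have h1 : b⁻¹ * (g * a) = 1 := by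
      refine eq_one_of_mem_Gamma_of_fixes_base hv (mul_mem (inv_mem hb) (mul_mem hg ha)) ?_
      rw [prodAct_mul, prodAct_inv_eq_iff, prodAct_mul, hax, hgx, hby]
    rw [eq_mul_inv_iff_mul_eq, ← inv_mul_eq_one.1 h1]

lemma presToLambda_injective [Finite k] {φ : ∀ τ : S0 S, Splitting c (τ : k)}
    {v : ProdVertex S} (hv : ∀ τ, IsBase (φ τ) (v τ)) :
    Function.Injective (presToLambda c S) := by
  rw [injective_iff_map_eq_one]
  intro p hp
  refine pres_eq_one_of_fixes hv (fun τ => ?_)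
  rw [hp, map_one, Equiv.Perm.one_apply]

end SimplyTransitive

/-! ### Torsion -/

section Torsion

variable {k : Type*} [Field k] {c : k} {S : Finset (OnePoint k)}

/-- The elements of `Γ_S` are represented by polynomial quaternions congruent to `1` modulo `F`. -/
lemma exists_rep_of_mem_Gamma {g : Lambda c S} (hg : g ∈ Gamma c S) :
    ∃ (u : (Quat c (SInt S))ˣ) (x : Quat c k[X]), QuotientGroup.mk u = g ∧
      u.1 = Quat.map c (Algebra.ofId k[X] (SInt S)) x ∧ evalFst 0 x = 1 := by
  have key : ∀ (τ : S0 S) (α : ConstExt c) (hα : α.norm = (τ : k)⁻¹) (g : Lambda c S),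
      (∃ (u : (Quat c (SInt S))ˣ) (x : Quat c k[X]), QuotientGroup.mk u = g ∧
        u.1 = Quat.map c (Algebra.ofId k[X] (SInt S)) x ∧ evalFst 0 x = 1) →
      ∃ (u : (Quat c (SInt S))ˣ) (x : Quat c k[X]), QuotientGroup.mk u = cls τ α hα * g ∧
        u.1 = Quat.map c (Algebra.ofId k[X] (SInt S)) x ∧ evalFst 0 x = 1 := by
    rintro τ α hα _ ⟨u, x, rfl, hux, hx⟩
    refine ⟨(isUnit_onePlus τ α hα).unit * u, onePlus k[X] α * x, rfl, ?_, ?_⟩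
    · rw [Units.val_mul, map_mul, hux, map_onePlus]
      rfl
    · rw [evalFst_mul, hx]
      simp
  induction hg using Subgroup.closure_induction_left with
  | one => exact ⟨1, 1, rfl, by simp, by ext <;> simp [evalFst] <;> rfl⟩
  | mul_left a ha y hy ih =>
    obtain ⟨τ, α, hα, rfl⟩ := Set.mem_iUnion.1 ha
    exact key τ α hα y ih
  | inv_mul_cancel a ha y hy ih =>
    obtain ⟨τ, α, hα, rfl⟩ := Set.mem_iUnion.1 ha
    rw [← cls_neg]
    exact key τ (-α) _ y ih

/-- The form `c p ^ 2 + t (q ^ 2 - c r ^ 2)` over `k[t]` is anisotropic. -/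
lemma eq_zero_of_ternary_form_eq_zero (hc : ¬ IsSquare c) {p q r : k[X]}
    (h : C c * p ^ 2 + X * (q ^ 2 - C c * r ^ 2) = 0) : p = 0 ∧ q = 0 ∧ r = 0 := by
  have hc0 : c ≠ 0 := by
    rintro rfl
    exact hc (IsSquare.zero)
  -- Infinite descent at `t = 0`: a zero of the form has `t ∣ p`, and then `q(0) ^ 2 = c r(0) ^ 2`
  -- forces `t ∣ q` and `t ∣ r` because `c` is not a square. Dividing by `t` gives another zero.
  have key : ∀ n : ℕ, ∀ p q r : k[X], C c * p ^ 2 + X * (q ^ 2 - C c * r ^ 2) = 0 →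
      X ^ n ∣ p ∧ X ^ n ∣ q ∧ X ^ n ∣ r := by
    intro n
    induction n with
    | zero => simp
    | succ n ih =>
      intro p q r h
      have hp : X ∣ p := by
        rw [X_dvd_iff, coeff_zero_eq_eval_zero]
        have := congrArg (eval 0) h
        simpa [hc0] using this
      obtain ⟨p, rfl⟩ := hp
      have h' : C c * X * p ^ 2 + (q ^ 2 - C c * r ^ 2) = 0 := by
        apply mul_left_cancel₀ (X_ne_zero (R := k))
        rw [mul_zero, ← h]
        ring
      have h0 : q.eval 0 ^ 2 - c * r.eval 0 ^ 2 = 0 := by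
        have := congrArg (eval 0) h'
        simpa using this
      have hr0 : r.eval 0 = 0 := by
        by_contra hr
        refine hc ⟨q.eval 0 / r.eval 0, ?_⟩
        field_simp
        linear_combination -h0
      have hq0 : q.eval 0 = 0 := by
        rw [hr0] at h0
        simpa using h0
      obtain ⟨q, rfl⟩ : X ∣ q := by rwa [X_dvd_iff, coeff_zero_eq_eval_zero]
      obtain ⟨r, rfl⟩ : X ∣ r := by rwa [X_dvd_iff, coeff_zero_eq_eval_zero]
      have h'' : C c * p ^ 2 + X * (q ^ 2 - C c * r ^ 2) = 0 := by
        apply mul_left_cancel₀ (X_ne_zero (R := k))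
        rw [mul_zero, ← h']
        ring
      obtain ⟨h1, h2, h3⟩ := ih p q r h''
      rw [pow_succ']
      exact ⟨mul_dvd_mul_left _ h1, mul_dvd_mul_left _ h2, mul_dvd_mul_left _ h3⟩
  have hz : ∀ f : k[X], (∀ n, X ^ n ∣ f) → f = 0 := fun f hf =>
    eq_zero_of_dvd_of_natDegree_lt (hf (f.natDegree + 1)) (by simp)
  exact ⟨hz p fun n => (key n p q r h).1, hz q fun n => (key n p q r h).2.1,
    hz r fun n => (key n p q r h).2.2⟩

/-- If a prime power `x ^ ℓ` of a polynomial quaternion `x ≡ 1` modulo `F` is a scalar, then so is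
`x`. -/
lemma eq_algebraMap_of_pow_eq_algebraMap [Finite k] (hk : ringChar k ≠ 2) (hc : ¬ IsSquare c)
    {ℓ : ℕ} (hℓ : ℓ.Prime) {x : Quat c k[X]} (hx : evalFst 0 x = 1) {s : k[X]}
    (h : x ^ ℓ = algebraMap _ _ s) : x = algebraMap k[X] _ x.re := by
  -- `w` is the pure part of `x`, and its square is the scalar `d`. So every power of `x` has the
  -- form `A + B w`, and it suffices to find `B ≠ 0` at the exponent `ℓ`.
  set w : Quat c k[X] := ⟨0, x.imI, x.imJ, x.imK⟩ with hw
  set d : k[X] := C c * x.imI ^ 2 + X * (x.imJ ^ 2 - C c * x.imK ^ 2) with hd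
  have hxw : x = algebraMap k[X] _ x.re + w := by
    ext <;> simp [hw, algebraMap_quat]
  have hww : w * w = algebraMap k[X] _ d := by
    apply QuaternionAlgebra.ext <;> simp [hw, hd, algebraMap_quat] <;> ring
  have hre : x.re.eval 0 = 1 := congrArg QuadraticAlgebra.re hx
  have him : x.imI.eval 0 = 0 := congrArg QuadraticAlgebra.im hx
  have hd0 : d.eval 0 = 0 := by simp [hd, him]
  clear_value d w
  suffices hw0 : w = 0 by rw [hw0, add_zero] at hxw; exact hxw
  obtain ⟨B, A, hB0, hB⟩ : ∃ B A : k[X], (B ≠ 0 ∨ w = 0) ∧ x ^ ℓ = algebraMap _ _ A + B • w := by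
    -- If `ℓ = 2 m + 1` is the characteristic, then `x ^ ℓ = x.re ^ ℓ + d ^ m w`, and `d = 0` only
    -- for `w = 0` by anisotropy. Otherwise `B` is detected at `t = 0`: there `x.re = 1` and `d =
    -- 0`, so `B` takes the value `ℓ ≠ 0`.
    by_cases hℓk : (ℓ : k) = 0
    · have hfact : Fact ℓ.Prime := ⟨hℓ⟩
      have hchar : CharP k ℓ := by
        have h1 := CharP.cast_eq_zero_iff k (ringChar k) ℓ |>.1 hℓk
        have h2 : (ringChar k).Prime := CharP.char_is_prime k _
        rw [← (Nat.prime_dvd_prime_iff_eq h2 hℓ).1 h1]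
        infer_instance
      have hinj : Function.Injective (algebraMap k[X] (Quat c k[X])) := fun a b hab => by
        simpa [algebraMap_quat] using congrArg QuaternionAlgebra.re hab
      have hcharq : CharP (Quat c k[X]) ℓ := charP_of_injective_algebraMap hinj ℓ
      obtain ⟨m, hm⟩ : Odd ℓ := by
        rcases hℓ.eq_two_or_odd' with h2 | h2
        · exact absurd (by rw [← h2]; exact ringChar.eq k ℓ) hk
        · exact h2
      refine ⟨d ^ m, x.re ^ ℓ, ?_, ?_⟩
      · by_cases hd0 : d = 0
        · right
          rw [hd] at hd0
          obtain ⟨h1, h2, h3⟩ := eq_zero_of_ternary_form_eq_zero hc hd0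
          rw [hw, h1, h2, h3]
          rfl
        · exact Or.inl (pow_ne_zero _ hd0)
      · nth_rw 1 [hxw]
        rw [add_pow_char_of_commute _ (Algebra.commutes _ _ : Commute _ _), ← map_pow]
        congr 1
        rw [hm, pow_succ, pow_mul, sq, hww, ← map_pow, Algebra.smul_def]
    · have key : ∀ n : ℕ, ∃ A B : k[X], x ^ n = algebraMap _ _ A + B • w ∧ A.eval 0 = 1 ∧
          B.eval 0 = n := by
        intro n
        induction n with
        | zero => exact ⟨1, 0, by simp⟩
        | succ n ih =>
          obtain ⟨A, B, e, hA, hB⟩ := ih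
          refine ⟨A * x.re + B * d, A + B * x.re, ?_, by simp [hA, hre, hd0],
            by simp [hA, hB, hre, add_comm]⟩
          have hcomm : w * algebraMap k[X] _ x.re = x.re • w := by
            rw [Algebra.smul_def]
            exact (Algebra.commutes _ _).symm
          rw [pow_succ, e]
          nth_rw 1 [hxw]
          rw [add_mul, mul_add, mul_add, smul_mul_assoc, smul_mul_assoc, hww, hcomm, map_add,
            map_mul, ← Algebra.smul_def A w, add_smul, mul_smul, map_mul, ← Algebra.smul_def B]
          abel
      obtain ⟨A, B, e, -, hB⟩ := key ℓ
      refine ⟨B, A, Or.inl ?_, e⟩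
      rintro rfl
      exact hℓk (by rw [← hB, eval_zero])
  rcases hB0 with hB0 | hw0
  · rw [h] at hB
    have h1 := congrArg QuaternionAlgebra.imI hB
    have h2 := congrArg QuaternionAlgebra.imJ hB
    have h3 := congrArg QuaternionAlgebra.imK hB
    simp [algebraMap_quat, hw, hB0] at h1 h2 h3
    rw [hw, h1, h2, h3]
    rfl
  · exact hw0

lemma algebraMap_SInt_injective : Function.Injective (algebraMap k[X] (SInt S)) := by
  have h : Function.Injective (algebraMap k[X] (RatFunc k)) := IsFractionRing.injective _ _
  rw [IsScalarTower.algebraMap_eq k[X] (SInt S) (RatFunc k),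
    RingHom.coe_comp] at h
  exact Function.Injective.of_comp h

/-- The scalar `x ^ ℓ` is a priori only an `S`-integer, but `k[t]` embeds into the `S`-integers, so
the equation descends to polynomial quaternions. -/
lemma eq_one_of_prime_pow_eq_one [Finite k] (hk : ringChar k ≠ 2) (hc : ¬ IsSquare c)
    {g : Lambda c S} (hg : g ∈ Gamma c S) {ℓ : ℕ} (hℓ : ℓ.Prime) (h : g ^ ℓ = 1) : g = 1 := by
  obtain ⟨u, x, rfl, hux, hx⟩ := exists_rep_of_mem_Gamma hg
  rw [← QuotientGroup.mk_pow, QuotientGroup.eq_one_iff] at h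
  obtain ⟨a, ha⟩ := h
  have hu : Quat.map c (Algebra.ofId k[X] (SInt S)) (x ^ ℓ) = algebraMap _ _ (a : SInt S) := by
    rw [map_pow, ← hux, ← Units.val_pow_eq_pow_val, ← ha]
    rfl
  have hz : ∀ y : k[X], algebraMap k[X] (SInt S) y = 0 → y = 0 := fun y hy =>
    (map_eq_zero_iff _ algebraMap_SInt_injective).1 hy
  rw [algebraMap_quat] at hu
  have hs : x ^ ℓ = algebraMap k[X] _ (x ^ ℓ).re := by
    rw [algebraMap_quat]
    exact QuaternionAlgebra.ext rfl (hz _ (congrArg QuaternionAlgebra.imI hu))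
      (hz _ (congrArg QuaternionAlgebra.imJ hu)) (hz _ (congrArg QuaternionAlgebra.imK hu))
  have hx' := eq_algebraMap_of_pow_eq_algebraMap hk hc hℓ hx hs
  rw [QuotientGroup.eq_one_iff]
  refine mem_scalars_of_eq_algebraMap (a := algebraMap k[X] (SInt S) x.re) ?_
  rw [hux, hx', algebraMap_quat, algebraMap_quat]
  ext <;> simp [Quat.map]

/-- If the order is `ℓ m` with `ℓ` prime, then `(g ^ m) ^ ℓ = 1`, hence `g ^ m = 1` by the prime
case, although `m` is smaller than the order. -/
lemma eq_one_of_isOfFinOrder [Finite k] (hk : ringChar k ≠ 2) (hc : ¬ IsSquare c)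
    {g : Lambda c S} (hg : g ∈ Gamma c S) (h : IsOfFinOrder g) : g = 1 := by
  by_contra hne
  have hn : orderOf g ≠ 1 := by rwa [Ne, orderOf_eq_one_iff]
  obtain ⟨ℓ, hℓ, m, hm⟩ := Nat.exists_prime_and_dvd hn
  have h1 : (g ^ m) ^ ℓ = 1 := by
    rw [← pow_mul, mul_comm, ← hm, pow_orderOf_eq_one]
  have h2 := eq_one_of_prime_pow_eq_one hk hc (pow_mem hg m) hℓ h1
  have h3 := Nat.le_of_dvd (Nat.pos_of_ne_zero fun h0 => by
    rw [h0, mul_zero] at hm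
    exact h.orderOf_pos.ne' hm) (orderOf_dvd_of_pow_eq_one h2)
  have h4 : 0 < m := h.orderOf_pos.trans_le h3
  rw [hm] at h3
  nlinarith [hℓ.two_le]

end Torsion

/-! ### Cells -/

section Cells

variable {k : Type*} [Field k] {c : k} {S : Finset (OnePoint k)}

lemma tree_adj_smul {τ : k} (g : (Matrix (Fin 2) (Fin 2) (Kv τ))ˣ) {x y : Vertex (Ov τ) (Kv τ)}
    (h : (tree (Ov τ) (Kv τ)).Adj x y) : (tree (Ov τ) (Kv τ)).Adj (g • x) (g • y) := by
  have key : ∀ x y : Vertex (Ov τ) (Kv τ), (∃ L L' : Lattice2 (Ov τ) (Kv τ),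
      Quotient.mk (homothety (Ov τ) (Kv τ)) L = x ∧ Quotient.mk (homothety (Ov τ) (Kv τ)) L' = y ∧
        IsLocalRing.maximalIdeal (Ov τ) • L.1 ≤ L'.1 ∧ L'.1 ≤ L.1) →
      ∃ L L' : Lattice2 (Ov τ) (Kv τ), Quotient.mk (homothety (Ov τ) (Kv τ)) L = g • x ∧
        Quotient.mk (homothety (Ov τ) (Kv τ)) L' = g • y ∧
        IsLocalRing.maximalIdeal (Ov τ) • L.1 ≤ L'.1 ∧ L'.1 ≤ L.1 := by
    rintro _ _ ⟨L, L', rfl, rfl, h1, h2⟩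
    refine ⟨Lattice2.act g L, Lattice2.act g L', rfl, rfl, ?_, Submodule.map_mono h2⟩
    have := Submodule.map_mono (f := (Matrix.toLin' g.1).restrictScalars (Ov τ)) h1
    rwa [Submodule.map_smul''] at this
  rw [tree, SimpleGraph.fromRel_adj] at h ⊢
  exact ⟨fun e => h.1 (MulAction.injective g e), h.2.imp (key x y) (key y x)⟩

lemma isGraphCell_image_treeAct {τ : k} (φ : Splitting c τ) (g : Lambda c S)
    {s : Set (Vertex (Ov τ) (Kv τ))} (hs : IsGraphCell (tree (Ov τ) (Kv τ)) s) :
    IsGraphCell (tree (Ov τ) (Kv τ)) (treeAct φ g '' s) := by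
  induction g using QuotientGroup.induction_on with
  | H u =>
    obtain ⟨x, rfl⟩ | ⟨x, y, h, rfl⟩ := hs
    · exact Or.inl ⟨_, Set.image_singleton⟩
    · exact Or.inr ⟨_, _, tree_adj_smul _ h, Set.image_pair _ _ _⟩

lemma isCell_image_prodAct (φ : ∀ τ : S0 S, Splitting c (τ : k)) (g : Lambda c S)
    {s : Set (ProdVertex S)} (hs : IsCell s) : IsCell (prodAct φ g '' s) := by
  obtain ⟨e, he, rfl⟩ := hs
  exact ⟨_, fun τ => isGraphCell_image_treeAct (φ τ) g (he τ),
    Set.piMap_image_univ_pi (fun τ => treeAct (φ τ) g) e⟩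

lemma IsGraphCell.nonempty {V : Type*} {G : SimpleGraph V} {s : Set V} (hs : IsGraphCell G s) :
    s.Nonempty := by
  obtain ⟨x, rfl⟩ | ⟨x, y, -, rfl⟩ := hs
  · exact Set.singleton_nonempty x
  · exact Set.insert_nonempty x {y}

/-- A cell of a graph has at most two vertices, so a permutation whose orbit of `x` stays in it for
two steps returns to `x`. -/
lemma IsGraphCell.apply_apply_eq {V : Type*} {G : SimpleGraph V} {s : Set V}
    (hs : IsGraphCell G s) {f : Equiv.Perm V} {x : V} (h0 : x ∈ s) (h1 : f x ∈ s)
    (h2 : f (f x) ∈ s) : f (f x) = x := by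
  obtain ⟨a, rfl⟩ | ⟨a, b, -, rfl⟩ := hs
  · exact h2.trans h0.symm
  · have hinj : f (f x) = f x → f x = x := fun h => f.injective h
    have hcongr : f x = x → f (f x) = x := fun h => by rw [h, h]
    simp only [Set.mem_insert_iff, Set.mem_singleton_iff] at h0 h1 h2
    grind

/-- The square of an element that stabilizes a cell fixes a vertex. -/
lemma exists_prodAct_sq_eq {φ : ∀ τ : S0 S, Splitting c (τ : k)} {g : Lambda c S}
    {s : Set (ProdVertex S)} (hs : IsCell s) (h : prodAct φ g '' s = s) :
    ∃ x, prodAct φ (g ^ 2) x = x := by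
  obtain ⟨e, he, rfl⟩ := hs
  obtain ⟨x, hx⟩ := Set.univ_pi_nonempty_iff.2 fun τ => (he τ).nonempty
  have hmem : ∀ y ∈ Set.univ.pi e, prodAct φ g y ∈ Set.univ.pi e := fun y hy =>
    h ▸ Set.mem_image_of_mem _ hy
  refine ⟨x, funext fun τ => ?_⟩
  rw [sq, prodAct_mul]
  exact (he τ).apply_apply_eq (f := treeAct (φ τ) g) (hx τ trivial) (hmem x hx τ trivial)
    (hmem _ (hmem x hx) τ trivial)

end Cells

end

end QuatLattice

open QuatLattice in
theorem theorem2p15 {k : Type*} [Field k] [Fintype k] (hq : Odd (Fintype.card k))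
    (c : k) [hc : Fact (¬ IsSquare c)] (S : Finset (OnePoint k))
    (h0 : ((0 : k) : OnePoint k) ∈ S) (hinf : OnePoint.infty ∈ S) :
    (∃ e : PresentedGroup (relsInv c S ∪ relsSquare c S) ≃* Gamma c S,
      ∀ a : Gens c S, ((e (PresentedGroup.of a) : Gamma c S) : Lambda c S) = a) ∧
    (∀ τ : S0 S, Nonempty (Splitting c (τ : k))) ∧
    (∀ φ : ∀ τ : S0 S, Splitting c (τ : k),
      (∀ x y : ProdVertex S, ∃! g : Lambda c S, g ∈ Gamma c S ∧ prodAct φ g x = y) ∧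
      (∀ g ∈ Gamma c S, ∀ s : Set (ProdVertex S), IsCell s → IsCell (prodAct φ g '' s)) ∧
      (∀ g ∈ Gamma c S, ∀ s : Set (ProdVertex S), IsCell s → prodAct φ g '' s = s → g = 1)) ∧
    (∀ g ∈ Gamma c S, IsOfFinOrder g → g = 1) := by
  have hc0 : c ≠ 0 := fun h => hc.out (h ▸ IsSquare.zero)
  have hchar : ringChar k ≠ 2 := fun h => by
    rw [← Nat.not_even_iff_odd, Nat.even_iff] at hq
    exact hq (FiniteField.even_card_of_char_two h)
  have hsplit : ∀ τ : S0 S, Nonempty (Splitting c (τ : k)) := fun τ =>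
    let ⟨φ, _⟩ := exists_integral_splitting hq hc0 τ.2.1
    ⟨φ⟩
  have hbase : ∀ φ : ∀ τ : S0 S, Splitting c (τ : k), ∃ v : ProdVertex S,
      ∀ τ, IsBase (φ τ) (v τ) := fun φ => by
    choose v hv using fun τ : S0 S => exists_base_vertex hq hc0 τ.2.1 (φ τ)
    exact ⟨v, hv⟩
  have htor : ∀ g ∈ Gamma c S, IsOfFinOrder g → g = 1 := fun g hg h =>
    eq_one_of_isOfFinOrder hchar hc.out hg h
  refine ⟨?_, hsplit, fun φ => ?_, htor⟩
  · obtain ⟨v, hv⟩ := hbase fun τ => (hsplit τ).some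
    exact ⟨(MonoidHom.ofInjective (presToLambda_injective hv)).trans
      (MulEquiv.subgroupCongr presToLambda_range), presToLambda_of⟩
  · obtain ⟨v, hv⟩ := hbase φ
    refine ⟨existsUnique_prodAct_eq hv, fun g _ s hs => isCell_image_prodAct φ g hs,
      fun g hg s hs h => ?_⟩
    obtain ⟨x, hx⟩ := exists_prodAct_sq_eq hs h
    have h1 : prodAct φ (1 : Lambda c S) x = x := funext fun τ => by simp [prodAct]
    -- Both `g ^ 2` and `1` lie in `Γ_S` and fix `x`, so simple transitivity identifies them.
    have h2 : g ^ 2 = 1 :=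
      (existsUnique_prodAct_eq hv x x).unique ⟨pow_mem hg 2, hx⟩ ⟨one_mem _, h1⟩
    exact htor g hg (isOfFinOrder_iff_pow_eq_one.2 ⟨2, two_pos, h2⟩)
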